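/- **Setting.** Let $\mathcal A$ be a finite alphabet with $d\ge 2$ letters. A combinatorial datum $\pi=(\pi_t,\pi_b)$ is a pair of bijections $\mathcal A\to\{1,\dots,d\}$; it is admissible if $\pi_t^{-1}\{1,\dots,k\}\ne\pi_b^{-1}\{1,\dots,k\}$ for $1\le k\le d-1$, and cyclic if $\pi_b\circ\pi_t^{-1}$ is a cycle of length $d$. Let $\alpha_t,\alpha_b$ be the last letters of $\pi$, $\pi_t(\alpha_t)=\pi_b(\alpha_b)=d$. The top Rauzy operation (winner $\alpha_t$, loser $\alpha_b$) moves $\alpha_b$ immediately after $\alpha_t$ in the bottom row; the bottom one (winner $\alpha_b$, loser $\alpha_t$) moves $\alpha_t$ immediately after $\alpha_b$ in the top row. An arrow is one such operation, with matrix $B$ given by $Be_w=e_w+e_l$ for the winner $w$ and the loser $l$, and $Be_\chi=e_\chi$ for $\chi\neq w$; a Rauzy path is a finite (possibly empty) concatenation of arrows, with $B_{\gamma_1*\gamma_2}=B_{\gamma_2}B_{\gamma_1}$. For lengths $\lambda\in\mathbb R_+^{\mathcal A}$, $T(\pi,\lambda)$ is the interval exchange of $[0,\sum_\chi\lambda_\chi)$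 translating, for each $\alpha$, the interval of length $\lambda_\alpha$ with left endpoint $u^t_\alpha=\sum_{\pi_t(\chi)<\pi_t(\alpha)}\lambda_\chi$ onto the one with left endpoint $u^b_\alpha=\sum_{\pi_b(\chi)<\pi_b(\alpha)}\lambda_\chi$. **Full families.** $\mathcal G(\pi,[0,1))$ is the set of generalized interval exchanges $f:[0,1)\to[0,1)$ with datum $\pi$: there are two partitions of $[0,1)$ into right-open intervals $I^t_\alpha$, $I^b_\alpha$ (part of the data of $f$), in the order of $\pi_t$, respectively $\pi_b$, and $f:I^t_\alpha\to I^b_\alpha$ is an increasing homeomorphism for every $\alpha$. Its critical points and critical values are $u^t_\alpha(f)=\min I^t_\alpha$ and $u^b_\alpha(f)=\min I^b_\alpha$. A degeneration $D$ consists of a subalphabet $\emptyset\ne\mathcal A'\subsetneq\mathcal A$, a generalized interval exchange $f$ of $[0,1)$ with the datum obtained from $\pi$ by erasing the letters outside $\mathcal A'$, and for each $\alpha\in\mathcal A\setminus\mathcal A'$ a point $s_\alpha\in(\{u^t_\beta(f)\}_{\beta\in\mathcal A'}\cup\{1\})\times(\{u^b_\beta(f)\}_{\beta\in\mathcal A'}\cup\{1\})$.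 Let $\widehat{\mathcal G}$ be the union of $\mathcal G(\pi,[0,1))$ and the set of degenerations. For $D\in\widehat{\mathcal G}$ let $D_\alpha\subset[0,1]^2$ be the closure of the graph of the branch with letter $\alpha$ if there is one, and $\{s_\alpha\}$ otherwise; put $\mathrm{dist}(D,D')=\sum_\alpha\mathrm{dist}_H(D_\alpha,D'_\alpha)$ (Hausdorff distances). Let $\Delta^{\mathcal A}=\{\tau\in\mathbb R^{\mathcal A}:\tau_\alpha>0,\ \sum_\alpha\tau_\alpha=1\}$. A full family over $\pi$ is a continuous map $\tau\mapsto f_\tau$, $\Delta^{\mathcal A}\to\mathcal G(\pi,[0,1))$, such that $u^b_\alpha(f_\tau)=\sum_{\pi_b(\chi)<\pi_b(\alpha)}\tau_\chi$ for all $\tau,\alpha$, and which extends to a continuous map $\overline{\Delta^{\mathcal A}}\to\widehat{\mathcal G}$. **Configurations.** Fix an admissible $\pi$, a Rauzy path $\gamma:\pi\to\pi^{(*)}$ with $\pi^{(*)}$ cyclic, and a full family $(f_\tau)$ over $\pi$. Put $q=B_\gamma\vec 1$, $N=\sum_\chi q_\chi$, $T_\gamma=T(\pi,N^{-1}\,{}^tB_\gamma\vec1)$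 (acting on $[0,1)$) and $T_\gamma^{(r)}=T(\pi^{(*)},N^{-1}\vec 1)$. For $\alpha\in\mathcal A$ let $h(\alpha)$ be the unique integer with $0\le h(\alpha)<q_\alpha$ and $T_\gamma^{h(\alpha)}(u^t_\alpha(T_\gamma^{(r)}))=u^t_\alpha(T_\gamma)$. Let $\mathcal I(\gamma)$ be the quotient of $\mathcal A\times\mathbb Z$ by the equivalence relation generated by $$(\alpha,i)\sim(\beta,j)\iff \pi^{(*)}_t(\beta)=\pi^{(*)}_b(\alpha)\ \text{ and }\ i-j=q_\alpha+h(\beta)-h(\alpha),$$ and write $[\alpha,i]$ for the classes. The reference points are $\underline{v}([\alpha,i])=T_\gamma^i(u^t_\alpha(T_\gamma))$. A $\gamma$-configuration is a family $\mathcal V$ of distinct points $v(x)\in[0,1)$, $x\in\mathcal I(\gamma)$, with $v([\alpha_0,0])=0$ where $\pi_t(\alpha_0)=1$, and $v(x)<v(y)\iff\underline v(x)<\underline v(y)$ for all $x,y$. Let $\mathcal O(\gamma)$ be the set of $\gamma$-configurations. A degenerate configuration is a pointwise limit $v:\mathcal I(\gamma)\to[0,1]$ of $\gamma$-configurations such that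 $v(x)=v(y)$ for some $x\ne y$, or $v(x)=1$ for some $x$; their set is $\partial\mathcal O(\gamma)$. For $x\in\mathcal I(\gamma)$ the face $\partial^{x}\mathcal O(\gamma)$ is the set of degenerate configurations with $v(x)=1$ if $\underline v(x)$ is the largest reference point, and with $v(x)=v(x^*)$ otherwise, where $\underline v(x^*)$ is the smallest reference point greater than $\underline v(x)$. Put $\overline{\mathcal O(\gamma)}=\mathcal O(\gamma)\cup\bigcup_{x}\partial^x\mathcal O(\gamma)$, with the sup-norm topology. For $\mathcal V\in\mathcal O(\gamma)$ let $\tau(\mathcal V)\in\Delta^{\mathcal A}$ have entries $\tau_\alpha=v([\alpha^*,1])-v([\alpha,1])$, where $\pi_b(\alpha^*)=\pi_b(\alpha)+1$, if $\pi_b(\alpha)<d$, and $\tau_\alpha=1-v([\alpha,1])$ if $\pi_b(\alpha)=d$. The Thurston map is $\mathcal T_\gamma(\mathcal V)=\{v'([\alpha,i])\}$ with $v'([\alpha,i])=f_{\tau(\mathcal V)}^{-1}\big(v([\alpha,i+1])\big)$. **Proposition.** $\mathcal T_\gamma$ maps $\mathcal O(\gamma)$ into $\mathcal O(\gamma)$,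 and there is a map $\widehat{\mathcal T}_\gamma:\overline{\mathcal O(\gamma)}\to\overline{\mathcal O(\gamma)}$ such that: 1. $\widehat{\mathcal T}_\gamma(\mathcal V)=\mathcal T_\gamma(\mathcal V)$ for every $\mathcal V\in\mathcal O(\gamma)$; 2. $\widehat{\mathcal T}_\gamma$ is continuous on $\overline{\mathcal O(\gamma)}$; 3. $\widehat{\mathcal T}_\gamma(\partial\mathcal O(\gamma))\subset\partial\mathcal O(\gamma)$, and $\widehat{\mathcal T}_\gamma\big(\partial^{[\alpha,i]}\mathcal O(\gamma)\big)\subset\partial^{[\alpha,i-1]}\mathcal O(\gamma)$ for every $[\alpha,i]\in\mathcal I(\gamma)$. -/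

import Mathlib

open Set Filter Topology

/-- A combinatorial datum over the finite alphabet `A`: a pair of bijections from `A` to the set of
positions. Positions are numbered `0, …, d - 1`, where `d` is the number of letters. -/
structure CombDatum (A : Type*) [Fintype A] where
  top : A ≃ Fin (Fintype.card A)
  bot : A ≃ Fin (Fintype.card A)

/-- The two kinds of elementary Rauzy operations, top and bottom. -/
inductive RauzyType where
  | t
  | b

/-- For an injective position map `p`, the bijection of `B` with `{0, …, |B| - 1}` that numbers the
elements of `B` in the order of their positions. -/
noncomputable def rankEquiv {B : Type*} [Fintype B] {n : ℕ} (p : B → Fin n)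
    (hp : Function.Injective p) : B ≃ Fin (Fintype.card B) :=
  Equiv.ofBijective
    (fun x => ⟨(Finset.univ.filter (fun y => p y < p x)).card,
      Finset.card_lt_univ_of_notMem (x := x) (by simp)⟩)
    (by
      have key : ∀ x y : B, p x < p y →
          (Finset.univ.filter (fun z => p z < p x)).card
            < (Finset.univ.filter (fun z => p z < p y)).card := by
        intro x y h
        apply Finset.card_lt_card
        rw [Finset.ssubset_iff_of_subset]
        · exact ⟨x, by simpa using h, by simp⟩
        · intro z hz
          simp only [Finset.mem_filter, Finset.mem_univ, true_and] at hz ⊢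
          exact hz.trans h
      rw [Fintype.bijective_iff_injective_and_card]
      refine ⟨?_, by simp⟩
      intro x y h
      have h' := congrArg Fin.val h
      simp only at h'
      rcases lt_trichotomy (p x) (p y) with h1 | h1 | h1
      · exact absurd h' (key x y h1).ne
      · exact hp h1
      · exact absurd h' (key y x h1).ne')

/-- The permutation of the positions `{0, …, d - 1}` that fixes the positions up to `m`, moves the
last position to `m + 1`, and moves the other positions one step to the right. -/
noncomputable def insertLastAfter {d : ℕ} (m : Fin d) : Equiv.Perm (Fin d) :=
  Equiv.ofBijective
    (fun k => if hk : (k : ℕ) ≤ m then k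
      else if hl : (k : ℕ) + 1 = d then ⟨m + 1, by omega⟩
      else ⟨k + 1, by omega⟩)
    (by
      rw [← Finite.injective_iff_bijective]
      intro x y h
      have h' := congrArg Fin.val h
      apply Fin.ext
      dsimp only at h'
      split_ifs at h' <;> (try simp only at h') <;> omega)

namespace CombDatum

section combinatorics

variable {A : Type*} [Fintype A]

/-- `π` is admissible: no proper nonempty initial segment of the top row consists of the same
letters as the initial segment of the same length of the bottom row. -/
def IsAdmissible (π : CombDatum A) : Prop :=
  ∀ k : ℕ, 1 ≤ k → k < Fintype.card A →
    {α : A | (π.top α : ℕ) < k} ≠ {α : A | (π.bot α : ℕ) < k}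

/-- `π` is cyclic: the permutation `π_b ∘ π_t⁻¹` of the positions is a cycle of order `d`. -/
def IsCyclic (π : CombDatum A) : Prop :=
  Equiv.Perm.IsCycle (π.top.symm.trans π.bot) ∧
    orderOf (π.top.symm.trans π.bot : Equiv.Perm (Fin (Fintype.card A))) = Fintype.card A

/-- The reduction of `π` to the subalphabet `S`: the letters outside `S` are erased from both rows
and the positions are renumbered. -/
noncomputable def reduction (π : CombDatum A) (S : Finset A) : CombDatum S where
  top := rankEquiv (fun α : S => π.top α) (π.top.injective.comp Subtype.val_injective)
  bot := rankEquiv (fun α : S => π.bot α) (π.bot.injective.comp Subtype.val_injective)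

/-- Left endpoint of the top interval of the letter `α` when the letters have lengths `l` and the
intervals are juxtaposed from `0` on in the order of the top row. -/
def topPoint (π : CombDatum A) (l : A → ℝ) (α : A) : ℝ :=
  ∑ χ ∈ Finset.univ.filter (fun χ => π.top χ < π.top α), l χ

/-- Left endpoint of the bottom interval of the letter `α`, for lengths `l`. -/
def botPoint (π : CombDatum A) (l : A → ℝ) (α : A) : ℝ :=
  ∑ χ ∈ Finset.univ.filter (fun χ => π.bot χ < π.bot α), l χ

/-- The interval of the letter `α` in the top partition with lengths `l`. -/
def topInterval (π : CombDatum A) (l : A → ℝ) (α : A) : Set ℝ :=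
  Ico (π.topPoint l α) (π.topPoint l α + l α)

/-- The interval of the letter `α` in the bottom partition with lengths `l`. -/
def botInterval (π : CombDatum A) (l : A → ℝ) (α : A) : Set ℝ :=
  Ico (π.botPoint l α) (π.botPoint l α + l α)

/-- The interval exchange transformation `T(π, l)`: the translation taking the top interval of `α`
to its bottom interval, for every `α` (and the identity outside `[0, ∑ l)`). -/
noncomputable def iet (π : CombDatum A) (l : A → ℝ) (x : ℝ) : ℝ :=
  x + ∑ α, (π.topInterval l α).indicator (fun _ => π.botPoint l α - π.topPoint l α) x

variable [Nontrivial A]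

/-- The last position. -/
def lastPos (A : Type*) [Fintype A] [Nontrivial A] : Fin (Fintype.card A) :=
  ⟨Fintype.card A - 1, Nat.sub_lt Fintype.card_pos one_pos⟩

/-- The last letter `α_t` of the top row. -/
def lastTop (π : CombDatum A) : A := π.top.symm (lastPos A)

/-- The last letter `α_b` of the bottom row. -/
def lastBot (π : CombDatum A) : A := π.bot.symm (lastPos A)

/-- The first letter of the top row. -/
def firstTop (π : CombDatum A) : A := π.top.symm ⟨0, Fintype.card_pos⟩

/-- The elementary Rauzy operations. The top one moves `α_b` right after `α_t` in the bottom row,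
the bottom one moves `α_t` right after `α_b` in the top row. -/
noncomputable def rauzyMove (π : CombDatum A) : RauzyType → CombDatum A
  | .t => ⟨π.top, π.bot.trans (insertLastAfter (π.bot π.lastTop))⟩
  | .b => ⟨π.top.trans (insertLastAfter (π.top π.lastBot)), π.bot⟩

/-- Winner of the arrow of type `ε` starting at `π`. -/
def winner (π : CombDatum A) : RauzyType → A
  | .t => π.lastTop
  | .b => π.lastBot

/-- Loser of the arrow of type `ε` starting at `π`. -/
def loser (π : CombDatum A) : RauzyType → A
  | .t => π.lastBot
  | .b => π.lastTop

/-- A finite Rauzy path starting at `π` is the list of the types of its successive arrows. This is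
the datum at which the path ends. -/
noncomputable def pathEnd (π : CombDatum A) : List RauzyType → CombDatum A
  | [] => π
  | ε :: γ => pathEnd (π.rauzyMove ε) γ

variable [DecidableEq A]

/-- The matrix of an arrow: `B e_w = e_w + e_l` for the winner `w` and the loser `l`, and
`B e_χ = e_χ` for `χ ≠ w`. -/
def arrowMatrix (π : CombDatum A) (ε : RauzyType) : Matrix A A ℤ :=
  1 + Matrix.single (π.loser ε) (π.winner ε) 1

/-- The matrix of a path, with `B_{γ₁ * γ₂} = B_{γ₂} B_{γ₁}`. -/
noncomputable def pathMatrix (π : CombDatum A) : List RauzyType → Matrix A A ℤ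
  | [] => 1
  | ε :: γ => pathMatrix (π.rauzyMove ε) γ * π.arrowMatrix ε

/-- The vector `q = B_γ 1` of return times. -/
noncomputable def returnTime (π : CombDatum A) (γ : List RauzyType) : A → ℤ :=
  (π.pathMatrix γ).mulVec 1

/-- The integer `N(γ)`, the sum of the return times. -/
noncomputable def numPoints (π : CombDatum A) (γ : List RauzyType) : ℤ :=
  ∑ χ, π.returnTime γ χ

/-- The length datum `N⁻¹ · ᵗB_γ 1`. -/
noncomputable def refLength (π : CombDatum A) (γ : List RauzyType) (α : A) : ℝ :=
  (π.numPoints γ : ℝ)⁻¹ * (((π.pathMatrix γ).transpose.mulVec 1 α : ℤ) : ℝ)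

/-- The periodic interval exchange `T_γ` on `[0, 1)`. -/
noncomputable def refIET (π : CombDatum A) (γ : List RauzyType) : ℝ → ℝ :=
  π.iet (π.refLength γ)

/-- The critical points `u^t_α(T_γ)`. -/
noncomputable def refCrit (π : CombDatum A) (γ : List RauzyType) (α : A) : ℝ :=
  π.topPoint (π.refLength γ) α

/-- The critical points of the `r`-th Rauzy renormalization of `T_γ`, where `r` is the length of
`γ`. This renormalization is `T(π*, N⁻¹ · 1)`, where `π*` is the end of `γ`. -/
noncomputable def renormCrit (π : CombDatum A) (γ : List RauzyType) (α : A) : ℝ :=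
  (π.pathEnd γ).topPoint (fun _ => (π.numPoints γ : ℝ)⁻¹) α

/-- The integer `0 ≤ h < q_α` (there is exactly one) such that `T_γ^h` sends the critical point of
`α` for the renormalization of `T_γ` to the critical point of `α` for `T_γ`. -/
noncomputable def height (π : CombDatum A) (γ : List RauzyType) (α : A) : ℕ :=
  sInf {k : ℕ | (k : ℤ) < π.returnTime γ α ∧
    (π.refIET γ)^[k] (π.renormCrit γ α) = π.refCrit γ α}

/-- The identifications between pairs `(α, i)`. -/
def labelRel (π : CombDatum A) (γ : List RauzyType) (x y : A × ℤ) : Prop :=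
  (π.pathEnd γ).top y.1 = (π.pathEnd γ).bot x.1 ∧
    x.2 - y.2 = π.returnTime γ x.1 + π.height γ y.1 - π.height γ x.1

/-- The set `I(γ)` of labels: the quotient of `A × ℤ` by the equivalence relation generated by the
identifications. -/
def Label (π : CombDatum A) (γ : List RauzyType) : Type _ := Quot (π.labelRel γ)

/-- The class `[α, i]`. -/
def label (π : CombDatum A) (γ : List RauzyType) (α : A) (i : ℤ) : π.Label γ :=
  Quot.mk _ (α, i)

/-- The map `[α, i] ↦ [α, i + 1]`. -/
def succLabel (π : CombDatum A) (γ : List RauzyType) : π.Label γ → π.Label γ :=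
  Quot.map (fun x => (x.1, x.2 + 1)) (by
    rintro x y ⟨h1, h2⟩
    exact ⟨h1, by simpa using h2⟩)

end combinatorics

end CombDatum

/-- Integer iterates of a map that is a bijection of the set `s`. -/
noncomputable def intIterate (f : ℝ → ℝ) (s : Set ℝ) : ℤ → ℝ → ℝ
  | .ofNat n => f^[n]
  | .negSucc n => (Function.invFunOn f s)^[n + 1]

/-- A generalized interval exchange transformation of `[0, 1)` with combinatorial datum `π`. The top
and bottom partitions are given by the lengths of their intervals. Only the values of `toFun` on
`[0, 1)` matter. A strictly increasing continuous surjection of one right-open interval onto another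
is the same as an orientation preserving homeomorphism. -/
structure GIET {A : Type*} [Fintype A] (π : CombDatum A) where
  topLen : A → ℝ
  botLen : A → ℝ
  topLen_pos : ∀ α, 0 < topLen α
  botLen_pos : ∀ α, 0 < botLen α
  topLen_sum : ∑ α, topLen α = 1
  botLen_sum : ∑ α, botLen α = 1
  toFun : ℝ → ℝ
  strictMonoOn : ∀ α, StrictMonoOn toFun (π.topInterval topLen α)
  continuousOn : ∀ α, ContinuousOn toFun (π.topInterval topLen α)
  image_eq : ∀ α, toFun '' π.topInterval topLen α = π.botInterval botLen α

namespace GIET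

variable {A : Type*} [Fintype A] {π : CombDatum A}

/-- The critical points of `f`. -/
def critPoint (f : GIET π) (α : A) : ℝ := π.topPoint f.topLen α

/-- The critical values of `f`. -/
def critValue (f : GIET π) (α : A) : ℝ := π.botPoint f.botLen α

/-- The inverse of `f` as a bijection of `[0, 1)`. -/
noncomputable def inverse (f : GIET π) : ℝ → ℝ := Function.invFunOn f.toFun (Ico 0 1)

/-- The closure of the graph of the branch of `f` with letter `α`, in the Euclidean plane. -/
def branchClosure (f : GIET π) (α : A) : Set (WithLp 2 (ℝ × ℝ)) :=
  closure ((fun x : ℝ => WithLp.toLp 2 (x, f.toFun x)) '' π.topInterval f.topLen α)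

end GIET

/-- A degeneration of the generalized interval exchange transformations with datum `π`: a regular
part, whose datum is the reduction of `π` to a proper nonempty subalphabet, and one singular point
for each of the other letters, whose coordinates are endpoints of intervals of the two partitions
of the regular part. -/
structure Degeneration {A : Type*} [Fintype A] (π : CombDatum A) where
  letters : Finset A
  letters_nonempty : letters.Nonempty
  letters_ne_univ : letters ≠ Finset.univ
  regularPart : GIET (π.reduction letters)
  sing : {α : A // α ∉ letters} → ℝ × ℝ
  sing_fst : ∀ α, (sing α).1 ∈ range regularPart.critPoint ∪ {1}
  sing_snd : ∀ α, (sing α).2 ∈ range regularPart.critValue ∪ {1}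

/-- The space of generalized interval exchange transformations of `[0, 1)` with datum `π` and of
their degenerations. -/
inductive ExtGIET {A : Type*} [Fintype A] (π : CombDatum A) where
  | regular (f : GIET π) : ExtGIET π
  | degenerate (D : Degeneration π) : ExtGIET π

namespace ExtGIET

variable {A : Type*} [Fintype A] {π : CombDatum A}

open Classical in
/-- The part `D_α` of `D`: the closed graph of the branch with letter `α`, or the singular point
with letter `α`. -/
noncomputable def part (α : A) : ExtGIET π → Set (WithLp 2 (ℝ × ℝ))
  | .regular f => f.branchClosure α
  | .degenerate D =>
      if h : α ∈ D.letters then D.regularPart.branchClosure ⟨α, h⟩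
      else {WithLp.toLp 2 (D.sing ⟨α, h⟩)}

/-- The distance: the sum over the letters of the Hausdorff distances of the parts. -/
noncomputable def distance (D E : ExtGIET π) : ℝ :=
  ∑ α, Metric.hausdorffDist (D.part α) (E.part α)

/-- Continuity on `s`, with respect to `distance`, of a map into the extended space. -/
def ContinuousOnDist (G : (A → ℝ) → ExtGIET π) (s : Set (A → ℝ)) : Prop :=
  ∀ τ ∈ s, Tendsto (fun σ => (G σ).distance (G τ)) (𝓝[s] τ) (𝓝 0)

end ExtGIET

/-- The open standard simplex. Its closure is Mathlib's `stdSimplex ℝ A`. -/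
def openSimplex (A : Type*) [Fintype A] : Set (A → ℝ) :=
  {τ | (∀ α, 0 < τ α) ∧ ∑ α, τ α = 1}

/-- `F` restricts to a full family over `π` (the values of `F` outside the open simplex are
irrelevant). -/
structure IsFullFamily {A : Type*} [Fintype A] {π : CombDatum A} (F : (A → ℝ) → GIET π) :
    Prop where
  continuous : ExtGIET.ContinuousOnDist (fun τ => .regular (F τ)) (openSimplex A)
  critValue_eq : ∀ τ ∈ openSimplex A, ∀ α, (F τ).critValue α = π.botPoint τ α
  extends_continuously : ∃ G : (A → ℝ) → ExtGIET π,
    (∀ τ ∈ openSimplex A, G τ = .regular (F τ)) ∧ ExtGIET.ContinuousOnDist G (stdSimplex ℝ A)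

namespace CombDatum

section configurations

variable {A : Type*} [Fintype A] [Nontrivial A] [DecidableEq A]

/-- The point `T_γ^i (u^t_α(T_γ))` of the reference configuration with label `[α, i]`. It does not
depend on the representative `(α, i)`, so any representative may be chosen. -/
noncomputable def refPoint (π : CombDatum A) (γ : List RauzyType) (x : π.Label γ) : ℝ :=
  intIterate (π.refIET γ) (Ico 0 1) (Quot.out x).2 (π.refCrit γ (Quot.out x).1)

/-- The set of `γ`-configurations: families of distinct points of `[0, 1)`, indexed by the labels,
in the same order as the points of the reference configuration and with first point `0`. Families
of points carry the product topology, that is, the topology of the sup-norm. -/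
def configurations (π : CombDatum A) (γ : List RauzyType) : Set (π.Label γ → ℝ) :=
  {v | (∀ x, v x ∈ Ico (0 : ℝ) 1) ∧ Function.Injective v ∧ v (π.label γ π.firstTop 0) = 0 ∧
    ∀ x y, v x < v y ↔ π.refPoint γ x < π.refPoint γ y}

/-- The set of degenerate configurations, which is the boundary of the configuration space. -/
def boundary (π : CombDatum A) (γ : List RauzyType) : Set (π.Label γ → ℝ) :=
  {v | (∃ u : ℕ → π.Label γ → ℝ, (∀ n, u n ∈ π.configurations γ) ∧
      ∀ x, Tendsto (fun n => u n x) atTop (𝓝 (v x))) ∧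
    ((∃ x y, x ≠ y ∧ v x = v y) ∨ ∃ x, v x = 1)}

/-- `x` is the label of the rightmost point of the reference configuration. -/
def IsMaxLabel (π : CombDatum A) (γ : List RauzyType) (x : π.Label γ) : Prop :=
  ∀ y, π.refPoint γ y ≤ π.refPoint γ x

/-- `y` is the label of the point of the reference configuration right after that of `x`. -/
def IsNextLabel (π : CombDatum A) (γ : List RauzyType) (x y : π.Label γ) : Prop :=
  π.refPoint γ x < π.refPoint γ y ∧
    ∀ z, π.refPoint γ x < π.refPoint γ z → π.refPoint γ y ≤ π.refPoint γ z

/-- The face of the boundary with label `x`. -/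
def face (π : CombDatum A) (γ : List RauzyType) (x : π.Label γ) : Set (π.Label γ → ℝ) :=
  {v ∈ π.boundary γ | (π.IsMaxLabel γ x ∧ v x = 1) ∨ ∃ y, π.IsNextLabel γ x y ∧ v x = v y}

/-- The closed configuration space. -/
def closedConfigurations (π : CombDatum A) (γ : List RauzyType) : Set (π.Label γ → ℝ) :=
  π.configurations γ ∪ ⋃ x, π.face γ x

/-- The parameter `τ(v)` for which the critical values are the points `v([α, 1])`: its entry at `α`
is the distance from `v([α, 1])` to `v([α*, 1])`, where `α*` follows `α` in the bottom row, or to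
`1` if `α` is the last letter of the bottom row. -/
noncomputable def tau (π : CombDatum A) (γ : List RauzyType) (v : π.Label γ → ℝ) (α : A) : ℝ :=
  if h : (π.bot α : ℕ) + 1 < Fintype.card A then
    v (π.label γ (π.bot.symm ⟨(π.bot α : ℕ) + 1, h⟩) 1) - v (π.label γ α 1)
  else 1 - v (π.label γ α 1)

/-- The Thurston map: `v'([α, i]) = f_τ⁻¹(v([α, i + 1]))` with `τ = τ(v)`. -/
noncomputable def thurstonMap (π : CombDatum A) (γ : List RauzyType) (F : (A → ℝ) → GIET π)
    (v : π.Label γ → ℝ) : π.Label γ → ℝ :=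
  fun x => (F (π.tau γ v)).inverse (v (π.succLabel γ x))

end configurations

end CombDatum

/-!
The reference points `T_γ^i(u^t_α(T_γ))` must first be shown to depend on the label `[α, i]` only.
This is Rauzy induction (`CombDatum.rauzy_induction`, built from the single step
`CombDatum.iet_rauzyMove`): the periodic map at the end of `γ` is the map induced by `T_γ`, with
return times `q_α`, and the left endpoint of its interval `α` meets `u^t_α(T_γ)` before returning.
Cyclicity of the end of `γ` guarantees that winner and loser differ along the path. Hence `T_γ` acts
on the reference points as `succLabel` acts on the labels (`CombDatum.refPoint_succLabel`).

For a configuration `v` with parameter `τ = τ(v)`, the critical values of `f_τ` are the points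
`v([α, 1])`, so `v` distributes the labels among the bottom intervals of `f_τ` as the reference
points are distributed among those of `T_γ`. As the order of two points is determined by their top
intervals and by the order of their images (`GIET.lt_iff`), the Thurston map preserves
configurations (`CombDatum.thurstonMap_mem_configurations`).

For the extension, let `G` be the continuous extension of the family to the closed simplex. Each
part of `G τ` is compact, and the second coordinate is injective on it, since it is a point or the
closure of the graph of an increasing branch. So the Hausdorff convergence of the parts forces
points of the parts to converge as soon as their second coordinates do
(`ExtGIET.exists_tendsto_of_mem_part`). Applied to configurations converging to `v`, this gives for
every label `x` exactly one point of the part of `G (τ(v))` with the letter of `x` whose second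
coordinate is `v(succLabel x)`; its first coordinate is the value of the extension at `x`. The same
principle gives continuity. For the faces, the point of `[α, i - 1]` and the one that follows it lie
over the same branch closure as the point of `[α, i]` and the one that follows it
(`CombDatum.exists_next_mem_branchClosure`): if the latter two coincide in the limit, then so do the
former two.
-/

/-! ### Juxtaposed intervals -/

section leftPt

variable {A : Type*} [Fintype A] {n : ℕ}

/-- Left endpoint of the interval of the letter `α` when intervals of lengths `l` are juxtaposed
from `0` on in the order given by `e`. Both `CombDatum.topPoint` and `CombDatum.botPoint` are
instances. -/
def leftPt (e : A ≃ Fin n) (l : A → ℝ) (α : A) : ℝ :=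
  ∑ χ ∈ Finset.univ.filter (fun χ => e χ < e α), l χ

variable (e : A ≃ Fin n) {l : A → ℝ} {α β : A}

theorem leftPt_nonneg (hl : ∀ χ, 0 ≤ l χ) (α : A) : 0 ≤ leftPt e l α :=
  Finset.sum_nonneg fun χ _ => hl χ

theorem leftPt_of_val_eq_zero (h : (e α : ℕ) = 0) : leftPt e l α = 0 := by
  apply Finset.sum_eq_zero
  intro χ hχ
  simp only [Finset.mem_filter, Fin.lt_def] at hχ
  omega

theorem leftPt_add_eq_sum_insert [DecidableEq A] (l : A → ℝ) (α : A) :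
    leftPt e l α + l α = ∑ χ ∈ insert α (Finset.univ.filter (fun χ => e χ < e α)), l χ := by
  rw [Finset.sum_insert (by simp), add_comm, leftPt]

theorem leftPt_add_le (hl : ∀ χ, 0 ≤ l χ) (h : e α < e β) :
    leftPt e l α + l α ≤ leftPt e l β := by
  classical
  rw [leftPt_add_eq_sum_insert]
  refine Finset.sum_le_sum_of_subset_of_nonneg ?_ fun χ _ _ => hl χ
  intro χ hχ
  simp only [Finset.mem_insert, Finset.mem_filter, Finset.mem_univ, true_and] at hχ ⊢
  rcases hχ with rfl | hχ
  exacts [h, hχ.trans h]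

theorem leftPt_succ (h : (e β : ℕ) = e α + 1) : leftPt e l β = leftPt e l α + l α := by
  classical
  rw [leftPt_add_eq_sum_insert, leftPt]
  congr 1
  ext χ
  simp only [Finset.mem_insert, Finset.mem_filter, Finset.mem_univ, true_and, Fin.lt_def,
    ← e.injective.eq_iff (a := χ), Fin.ext_iff]
  omega

theorem leftPt_last (h : (e α : ℕ) + 1 = n) : leftPt e l α + l α = ∑ χ, l χ := by
  classical
  rw [leftPt_add_eq_sum_insert]
  congr 1
  ext χ
  simp only [Finset.mem_insert, Finset.mem_filter, Finset.mem_univ, true_and, Fin.lt_def,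
    ← e.injective.eq_iff (a := χ), Fin.ext_iff, iff_true]
  have := (e χ).isLt
  omega

theorem leftPt_add_le_sum (hl : ∀ χ, 0 ≤ l χ) (α : A) : leftPt e l α + l α ≤ ∑ χ, l χ := by
  classical
  rw [leftPt_add_eq_sum_insert]
  exact Finset.sum_le_sum_of_subset_of_nonneg (Finset.subset_univ _) fun χ _ _ => hl χ

theorem exists_mem_leftPt (l : A → ℝ) {x : ℝ} (hx : x ∈ Ico 0 (∑ χ, l χ)) :
    ∃ α, x ∈ Ico (leftPt e l α) (leftPt e l α + l α) := by
  have hn : 0 < n := by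
    by_contra hn
    obtain rfl : n = 0 := by omega
    have := e.isEmpty
    have h := hx.1.trans_lt hx.2
    simp at h
  obtain ⟨α, hα, hmax⟩ := Finset.exists_max_image
    (Finset.univ.filter fun χ => leftPt e l χ ≤ x) (fun χ => (e χ : ℕ))
    ⟨e.symm ⟨0, hn⟩, by simpa [leftPt_of_val_eq_zero] using hx.1⟩
  simp only [Finset.mem_filter, Finset.mem_univ, true_and] at hα hmax
  refine ⟨α, hα, ?_⟩
  by_contra! hle
  rcases Nat.lt_or_ge ((e α : ℕ) + 1) n with h | h
  · have h1 := hmax (e.symm ⟨e α + 1, h⟩) (by rwa [leftPt_succ e (α := α) (by simp)])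
    simp at h1
  · rw [leftPt_last e (by omega)] at hle
    exact absurd hx.2 (by simpa using hle)

theorem eq_of_mem_leftPt (hl : ∀ χ, 0 ≤ l χ) {x : ℝ}
    (hα : x ∈ Ico (leftPt e l α) (leftPt e l α + l α))
    (hβ : x ∈ Ico (leftPt e l β) (leftPt e l β + l β)) : α = β := by
  rcases lt_trichotomy (e α) (e β) with h | h | h
  · exact absurd (leftPt_add_le e hl h) (by linarith [hα.2, hβ.1])
  · exact e.injective h
  · exact absurd (leftPt_add_le e hl h) (by linarith [hβ.2, hα.1])

/-- Lengths are determined by the left endpoints and the total length. -/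
theorem eq_of_leftPt_eq {l' : A → ℝ} (h : ∀ α, leftPt e l α = leftPt e l' α)
    (hs : ∑ χ, l χ = ∑ χ, l' χ) (α : A) : l α = l' α := by
  rcases Nat.lt_or_ge ((e α : ℕ) + 1) n with hlt | hge
  · have h1 := leftPt_succ e (l := l) (α := α) (β := e.symm ⟨e α + 1, hlt⟩) (by simp)
    have h2 := leftPt_succ e (l := l') (α := α) (β := e.symm ⟨e α + 1, hlt⟩) (by simp)
    linarith [h α, h (e.symm ⟨e α + 1, hlt⟩)]
  · have h1 := leftPt_last e (l := l) (α := α) (by omega)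
    have h2 := leftPt_last e (l := l') (α := α) (by omega)
    linarith [h α]

/-- If the lengths are the consecutive differences of a function `g` that starts at `0`, then `g`
gives the left endpoints. -/
theorem leftPt_eq_of_diff {g : A → ℝ} (h0 : ∀ α, (e α : ℕ) = 0 → g α = 0)
    (hsucc : ∀ α β, (e β : ℕ) = e α + 1 → l α = g β - g α) (α : A) : leftPt e l α = g α := by
  obtain ⟨k, hk⟩ : ∃ k, (e α : ℕ) = k := ⟨_, rfl⟩
  induction k generalizing α with
  | zero => rw [leftPt_of_val_eq_zero e hk, h0 α hk]
  | succ k ih =>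
    have hkn : k < n := by omega
    have h1 : (e (e.symm ⟨k, hkn⟩) : ℕ) = k := by simp
    rw [leftPt_succ e (α := e.symm ⟨k, hkn⟩) (by omega), ih _ h1, hsucc _ α (by omega)]
    ring

theorem leftPt_const (c : ℝ) (α : A) : leftPt e (fun _ => c) α = (e α : ℕ) * c := by
  rw [leftPt, Finset.sum_const, nsmul_eq_mul]
  congr 2
  have h : (Finset.univ.filter fun χ => e χ < e α) = (Finset.Iio (e α)).map e.symm.toEmbedding := by
    ext χ
    simp [Finset.mem_map_equiv]
  rw [h, Finset.card_map, Fin.card_Iio]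

theorem leftPt_eq_sum_ite (l : A → ℝ) (α : A) :
    leftPt e l α = ∑ χ, if e χ < e α then l χ else 0 :=
  Finset.sum_filter _ _

/-- If only the length of a letter `w` that is last in the order changes, the left endpoints do
not. -/
theorem leftPt_congr_of_last {l' : A → ℝ} {w : A} (hw : (e w : ℕ) + 1 = n)
    (h : ∀ χ ≠ w, l χ = l' χ) (α : A) : leftPt e l α = leftPt e l' α := by
  refine Finset.sum_congr rfl fun χ hχ => h χ ?_
  rintro rfl
  simp only [Finset.mem_filter, Fin.lt_def] at hχ
  omega

end leftPt

section insertLast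

variable {A : Type*} [Fintype A] {n : ℕ} (e : A ≃ Fin n) {w s : A}

theorem insertLastAfter_val {d : ℕ} (m k : Fin d) : (insertLastAfter m k : ℕ) =
    if (k : ℕ) ≤ m then (k : ℕ) else if (k : ℕ) + 1 = d then (m : ℕ) + 1 else k + 1 := by
  simp only [insertLastAfter, Equiv.ofBijective_apply]
  split_ifs <;> rfl

/-- Moving the last letter `s` right after `w`, and shortening `w` by the length of `s`, does not
change the left endpoints of the other letters. -/
theorem leftPt_insertLast [DecidableEq A] (hs : (e s : ℕ) + 1 = n) (hws : w ≠ s)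
    {l l' : A → ℝ} (hl : ∀ χ, l χ = l' χ + if χ = w then l' s else 0) {α : A} (hα : α ≠ s) :
    leftPt (e.trans (insertLastAfter (e w))) l' α = leftPt e l α := by
  have h1 : leftPt e l α = leftPt e l' α + if e w < e α then l' s else 0 := by
    rw [leftPt_eq_sum_ite, leftPt_eq_sum_ite,
      ← Fintype.sum_ite_eq' w (fun χ => if e χ < e α then l' s else 0), ← Finset.sum_add_distrib]
    refine Finset.sum_congr rfl fun χ _ => ?_
    rw [hl]
    split_ifs <;> simp
  rw [h1, leftPt_eq_sum_ite, leftPt_eq_sum_ite,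
    ← Fintype.sum_ite_eq' s (fun χ => if e w < e α then l' χ else 0), ← Finset.sum_add_distrib]
  refine Finset.sum_congr rfl fun χ _ => ?_
  have e1 : (e α : ℕ) ≠ e s := fun h => hα (e.injective (Fin.ext h))
  have e2 : (e w : ℕ) ≠ e s := fun h => hws (e.injective (Fin.ext h))
  simp only [Equiv.trans_apply, Fin.lt_def, insertLastAfter_val]
  by_cases hχ : χ = s
  · subst hχ
    simp only [if_true]
    split_ifs <;> first | omega | simp
  · have e3 : (e χ : ℕ) ≠ e s := fun h => hχ (e.injective (Fin.ext h))
    simp only [hχ, if_false, add_zero]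
    split_ifs <;> first | omega | simp

/-- Left endpoint of the moved letter in `leftPt_insertLast`. -/
theorem leftPt_insertLast_self [DecidableEq A] (hs : (e s : ℕ) + 1 = n) (hws : w ≠ s)
    {l l' : A → ℝ} (hl : ∀ χ, l χ = l' χ + if χ = w then l' s else 0) :
    leftPt (e.trans (insertLastAfter (e w))) l' s = leftPt e l w + l' w := by
  have e2 : (e w : ℕ) ≠ e s := fun h => hws (e.injective (Fin.ext h))
  have h1 : leftPt e l w = leftPt e l' w := by
    refine Finset.sum_congr rfl fun χ hχ => ?_
    rw [hl, if_neg, add_zero]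
    rintro rfl
    simp at hχ
  rw [h1, leftPt_add_eq_sum_insert, leftPt]
  congr 1
  ext χ
  simp only [Finset.mem_insert, Finset.mem_filter, Finset.mem_univ, true_and, Fin.lt_def,
    ← e.injective.eq_iff (a := χ), Fin.ext_iff, Equiv.trans_apply, insertLastAfter_val]
  split_ifs <;> omega

end insertLast

/-! ### Rauzy induction -/

namespace CombDatum

section iet

variable {A : Type*} [Fintype A] (π : CombDatum A)

theorem topPoint_eq_leftPt (l : A → ℝ) : π.topPoint l = leftPt π.top l := rfl

theorem botPoint_eq_leftPt (l : A → ℝ) : π.botPoint l = leftPt π.bot l := rfl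

theorem iet_apply {l : A → ℝ} (hl : ∀ χ, 0 ≤ l χ) {α : A} {x : ℝ} (hx : x ∈ π.topInterval l α) :
    π.iet l x = x + (π.botPoint l α - π.topPoint l α) := by
  rw [iet, Finset.sum_eq_single α]
  · rw [indicator_of_mem hx]
  · intro β _ hβ
    exact indicator_of_notMem (fun h => hβ (eq_of_mem_leftPt π.top hl h hx)) _
  · simp

theorem topPoint_mem_topInterval {l : A → ℝ} {α : A} (hl : 0 < l α) :
    π.topPoint l α ∈ π.topInterval l α :=
  ⟨le_rfl, by linarith⟩

end iet

section rauzy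

variable {A : Type*} [Fintype A] [Nontrivial A] (π : CombDatum A)

theorem top_lastTop : (π.top π.lastTop : ℕ) + 1 = Fintype.card A := by
  have := Fintype.card_pos (α := A)
  simp only [lastTop, lastPos, Equiv.apply_symm_apply]
  omega

theorem bot_lastBot : (π.bot π.lastBot : ℕ) + 1 = Fintype.card A := by
  have := Fintype.card_pos (α := A)
  simp only [lastBot, lastPos, Equiv.apply_symm_apply]
  omega

theorem insertLastAfter_of_last {d : ℕ} {m : Fin d} (hm : (m : ℕ) + 1 = d) :
    insertLastAfter m = Equiv.refl _ := by
  ext k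
  rw [insertLastAfter_val, if_pos (by omega)]
  rfl

/-- A datum whose two rows end with the same letter is fixed by the Rauzy operations. -/
theorem rauzyMove_of_last_eq (h : π.lastTop = π.lastBot) (ε : RauzyType) : π.rauzyMove ε = π := by
  have h1 := π.top_lastTop
  have h2 := π.bot_lastBot
  cases ε
  · rw [← h] at h2
    simp only [rauzyMove, insertLastAfter_of_last h2]
    rfl
  · rw [h] at h1
    simp only [rauzyMove, insertLastAfter_of_last h1]
    rfl

theorem IsCyclic.lastTop_ne_lastBot {π : CombDatum A} (hπ : π.IsCyclic) :
    π.lastTop ≠ π.lastBot := by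
  intro h
  have h1 := hπ.1.orderOf
  rw [hπ.2] at h1
  have h2 : Equiv.Perm.support (π.top.symm.trans π.bot) = Finset.univ :=
    (Finset.card_eq_iff_eq_univ _).1 (by rw [← h1, Fintype.card_fin])
  have h3 : lastPos A ∈ Equiv.Perm.support (π.top.symm.trans π.bot) := by
    rw [h2]; exact Finset.mem_univ _
  rw [Equiv.Perm.mem_support] at h3
  apply h3
  rw [Equiv.trans_apply]
  change π.bot π.lastTop = _
  rw [h]
  exact Equiv.apply_symm_apply _ _

theorem pathEnd_append (γ : List RauzyType) (ε : RauzyType) :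
    π.pathEnd (γ ++ [ε]) = (π.pathEnd γ).rauzyMove ε := by
  induction γ generalizing π with
  | nil => rfl
  | cons δ γ ih => exact ih _

variable [DecidableEq A]

theorem pathMatrix_append (γ : List RauzyType) (ε : RauzyType) :
    π.pathMatrix (γ ++ [ε]) = (π.pathEnd γ).arrowMatrix ε * π.pathMatrix γ := by
  induction γ generalizing π with
  | nil => simp [pathMatrix, pathEnd]
  | cons δ γ ih =>
    simp only [List.cons_append, pathMatrix, pathEnd, ih, Matrix.mul_assoc]

/-- Lengths at the start of an arrow, from the lengths `l` at its end: the winner is longer by the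
length of the loser. -/
def arrowLength (ε : RauzyType) (l : A → ℝ) (χ : A) : ℝ :=
  l χ + if χ = π.winner ε then l (π.loser ε) else 0

/-- One step of Rauzy induction: the first return map `T(π', l)` of `T(π, l₁)` is `T(π, l₁)` away
from the loser's interval, and `T(π, l₁)²` on the loser's interval. On that interval, the first
letter visited and the next one are the loser and the winner in this order for a top arrow, and in
the opposite order for a bottom arrow. -/
theorem iet_rauzyMove (h : π.lastTop ≠ π.lastBot) (ε : RauzyType) {l : A → ℝ}
    (hl : ∀ χ, 0 < l χ) :
    (∀ α ≠ π.loser ε, (π.rauzyMove ε).topPoint l α = π.topPoint (π.arrowLength ε l) α ∧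
      ∀ x ∈ (π.rauzyMove ε).topInterval l α, x ∈ π.topInterval (π.arrowLength ε l) α ∧
        π.iet (π.arrowLength ε l) x = (π.rauzyMove ε).iet l x) ∧
    ∃ a b : A, (a = π.loser ε ∧ b = π.winner ε ∨ a = π.winner ε ∧ b = π.loser ε) ∧
      (a = π.loser ε ∧ (π.rauzyMove ε).topPoint l (π.loser ε) =
          π.topPoint (π.arrowLength ε l) (π.loser ε) ∨
       a = π.winner ε ∧ π.iet (π.arrowLength ε l) ((π.rauzyMove ε).topPoint l (π.loser ε)) =
          π.topPoint (π.arrowLength ε l) (π.loser ε)) ∧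
      ∀ x ∈ (π.rauzyMove ε).topInterval l (π.loser ε),
        x ∈ π.topInterval (π.arrowLength ε l) a ∧
        π.iet (π.arrowLength ε l) x ∈ π.topInterval (π.arrowLength ε l) b ∧
        π.iet (π.arrowLength ε l) (π.iet (π.arrowLength ε l) x) = (π.rauzyMove ε).iet l x := by
  have hne : π.winner ε ≠ π.loser ε := by
    cases ε
    exacts [h, h.symm]
  set l₁ := π.arrowLength ε l with hl₁
  have hl1 : ∀ χ, l₁ χ = l χ + if χ = π.winner ε then l (π.loser ε) else 0 := fun χ => rfl
  have hl1w : l₁ (π.winner ε) = l (π.winner ε) + l (π.loser ε) := by rw [hl1, if_pos rfl]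
  have hl1n : ∀ χ ≠ π.winner ε, l₁ χ = l χ := fun χ hχ => by rw [hl1, if_neg hχ, add_zero]
  have hle : ∀ χ, l χ ≤ l₁ χ := fun χ => by
    rw [hl1]; split_ifs <;> linarith [hl (π.loser ε)]
  have hl0 : ∀ χ, 0 ≤ l₁ χ := fun χ => (hl χ).le.trans (hle χ)
  have hl' : ∀ χ, 0 ≤ l χ := fun χ => (hl χ).le
  have htot1 := leftPt_last π.top (l := l₁) π.top_lastTop
  have htot2 := leftPt_last π.bot (l := l₁) π.bot_lastBot
  have hlos := hl1n _ hne.symm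
  cases ε with
  | t =>
    simp only [winner, loser] at *
    have ht : ∀ α, (π.rauzyMove .t).topPoint l α = π.topPoint l₁ α := fun α =>
      leftPt_congr_of_last π.top π.top_lastTop (fun χ hχ => (hl1n χ hχ).symm) α
    have hb : ∀ α ≠ π.lastBot, (π.rauzyMove .t).botPoint l α = π.botPoint l₁ α := fun α hα =>
      leftPt_insertLast π.bot π.bot_lastBot h hl1 hα
    have hbs : (π.rauzyMove .t).botPoint l π.lastBot = π.botPoint l₁ π.lastTop + l π.lastTop :=
      leftPt_insertLast_self π.bot π.bot_lastBot h hl1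
    have hsub : ∀ α, ∀ x ∈ (π.rauzyMove .t).topInterval l α, x ∈ π.topInterval l₁ α := by
      intro α x hx
      have := hx.2
      rw [ht] at this
      exact ⟨(ht α).symm.le.trans hx.1, by linarith [hle α]⟩
    refine ⟨fun α hα => ⟨ht α, fun x hx => ⟨hsub α x hx, ?_⟩⟩, π.lastBot, π.lastTop,
      Or.inl ⟨rfl, rfl⟩, Or.inl ⟨rfl, ht _⟩, fun x hx => ?_⟩
    · rw [iet_apply _ hl' hx, iet_apply _ hl0 (hsub α x hx), ht, hb α hα]
    · have h1 := hsub _ x hx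
      have h2 := iet_apply π hl0 h1
      have h3 : π.iet l₁ x ∈ π.topInterval l₁ π.lastTop := by
        rw [h2]
        have := h1.1
        have := h1.2
        simp only [topInterval, topPoint_eq_leftPt, botPoint_eq_leftPt, mem_Ico] at *
        constructor <;> linarith [hl π.lastTop]
      refine ⟨h1, h3, ?_⟩
      rw [iet_apply π hl0 h3, iet_apply _ hl' hx, hbs, ht, h2]
      simp only [topPoint_eq_leftPt, botPoint_eq_leftPt] at *
      linarith
  | b =>
    simp only [winner, loser] at *
    have hb : ∀ α, (π.rauzyMove .b).botPoint l α = π.botPoint l₁ α := fun α =>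
      leftPt_congr_of_last π.bot π.bot_lastBot (fun χ hχ => (hl1n χ hχ).symm) α
    have ht : ∀ α ≠ π.lastTop, (π.rauzyMove .b).topPoint l α = π.topPoint l₁ α := fun α hα =>
      leftPt_insertLast π.top π.top_lastTop h.symm hl1 hα
    have hts : (π.rauzyMove .b).topPoint l π.lastTop = π.topPoint l₁ π.lastBot + l π.lastBot :=
      leftPt_insertLast_self π.top π.top_lastTop h.symm hl1
    have hsub : ∀ α ≠ π.lastTop, ∀ x ∈ (π.rauzyMove .b).topInterval l α,
        x ∈ π.topInterval l₁ α := by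
      intro α hα x hx
      have := hx.2
      rw [ht α hα] at this
      exact ⟨(ht α hα).symm.le.trans hx.1, by linarith [hle α]⟩
    have key : ∀ x ∈ (π.rauzyMove .b).topInterval l π.lastTop,
        x ∈ π.topInterval l₁ π.lastBot ∧
        π.iet l₁ x = x + (π.botPoint l₁ π.lastBot - π.topPoint l₁ π.lastBot) := by
      intro x hx
      have h1 : x ∈ π.topInterval l₁ π.lastBot := by
        have := hx.1
        have := hx.2
        constructor <;> linarith [hl π.lastBot]
      exact ⟨h1, iet_apply π hl0 h1⟩
    refine ⟨fun α hα => ⟨ht α hα, fun x hx => ⟨hsub α hα x hx, ?_⟩⟩, π.lastBot, π.lastTop,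
      Or.inr ⟨rfl, rfl⟩, Or.inr ⟨rfl, ?_⟩, fun x hx => ?_⟩
    · rw [iet_apply _ hl' hx, iet_apply _ hl0 (hsub α hα x hx), ht α hα, hb]
    · rw [(key _ (topPoint_mem_topInterval _ (hl _))).2, hts]
      simp only [topPoint_eq_leftPt, botPoint_eq_leftPt] at *
      linarith
    · obtain ⟨h1, h2⟩ := key x hx
      have h3 : π.iet l₁ x ∈ π.topInterval l₁ π.lastTop := by
        rw [h2]
        have := hx.1
        have := hx.2
        simp only [topInterval, topPoint_eq_leftPt, botPoint_eq_leftPt, mem_Ico] at *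
        constructor <;> linarith
      refine ⟨h1, h3, ?_⟩
      rw [iet_apply π hl0 h3, iet_apply _ hl' hx, hts, hb, h2]
      simp only [topPoint_eq_leftPt, botPoint_eq_leftPt] at *
      linarith

/-- Lengths at the start of a path, from the lengths `l` at its end: `ᵗB_γ l`. -/
noncomputable def pathLength (γ : List RauzyType) (l : A → ℝ) (α : A) : ℝ :=
  ∑ β, (π.pathMatrix γ β α : ℝ) * l β

theorem pathLength_append (γ : List RauzyType) (ε : RauzyType) (l : A → ℝ) :
    π.pathLength (γ ++ [ε]) l = π.pathLength γ ((π.pathEnd γ).arrowLength ε l) := by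
  funext α
  simp only [pathLength, pathMatrix_append, arrowLength, arrowMatrix, add_mul, one_mul,
    Matrix.add_apply, Int.cast_add, mul_add, Finset.sum_add_distrib]
  congr 1
  rw [Finset.sum_eq_single ((pathEnd π γ).loser ε), Finset.sum_eq_single ((pathEnd π γ).winner ε)]
  · simp
  · intro b _ hb
    simp [hb]
  · simp
  · intro b _ hb
    rw [Matrix.single_mul_apply_of_ne _ _ _ _ _ hb]
    simp
  · simp

theorem returnTime_append (γ : List RauzyType) (ε : RauzyType) (α : A) :
    π.returnTime (γ ++ [ε]) α = π.returnTime γ α +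
      if α = (π.pathEnd γ).loser ε then π.returnTime γ ((π.pathEnd γ).winner ε) else 0 := by
  rw [returnTime, pathMatrix_append, arrowMatrix, add_mul, one_mul, Matrix.add_mulVec, Pi.add_apply,
    returnTime, ← Matrix.mulVec_mulVec]
  congr 1
  rw [Matrix.mulVec, dotProduct, Finset.sum_eq_single ((pathEnd π γ).winner ε)]
  · split_ifs with h
    · simp [h]
    · rw [Matrix.single_apply_of_row_ne (Ne.symm h), zero_mul]
  · intro b _ hb
    rw [Matrix.single_apply_of_col_ne _ _ (Ne.symm hb), zero_mul]
  · simp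

/-- Rauzy induction along a path: `T(π', l)`, where `π'` is the end of the path `γ`, is the map
induced by `T = T(π, ᵗB_γ l)`, with return time `q_α` on the interval of `α`; before returning, the
left endpoint of that interval passes through the critical point of `α` for `T`. -/
theorem rauzy_induction (γ : List RauzyType) (hγ : (π.pathEnd γ).lastTop ≠ (π.pathEnd γ).lastBot)
    {l : A → ℝ} (hl : ∀ χ, 0 < l χ) :
    (∀ α, 0 < π.pathLength γ l α) ∧ ∀ α, ∃ q : ℕ, (q : ℤ) = π.returnTime γ α ∧
      (∀ x ∈ (π.pathEnd γ).topInterval l α,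
        (π.iet (π.pathLength γ l))^[q] x = (π.pathEnd γ).iet l x) ∧
      ∃ k < q, (π.iet (π.pathLength γ l))^[k] ((π.pathEnd γ).topPoint l α) =
        π.topPoint (π.pathLength γ l) α := by
  -- Adding the last arrow composes the induced maps, so that the return times add up.
  induction γ using List.reverseRecOn generalizing l with
  | nil =>
    have h1 : π.pathLength [] l = l := by
      funext α
      simp [pathLength, pathMatrix, Matrix.one_apply]
    rw [h1]
    refine ⟨hl, fun α => ⟨1, ?_, fun x _ => rfl, 0, one_pos, rfl⟩⟩
    simp [returnTime, pathMatrix]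
  | append_singleton γ ε ih =>
    have hne : (π.pathEnd γ).lastTop ≠ (π.pathEnd γ).lastBot := by
      intro h
      rw [pathEnd_append, rauzyMove_of_last_eq _ h] at hγ
      exact hγ h
    have hl1 : ∀ χ, 0 < (π.pathEnd γ).arrowLength ε l χ := fun χ => by
      rw [arrowLength]
      split_ifs <;> linarith [hl χ, hl ((π.pathEnd γ).loser ε)]
    obtain ⟨hpos, hret⟩ := ih hne hl1
    rw [pathLength_append, pathEnd_append]
    refine ⟨hpos, fun α => ?_⟩
    rw [returnTime_append]
    obtain ⟨hother, a, b, hab, hpt, hlos⟩ := iet_rauzyMove (π.pathEnd γ) hne ε hl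
    by_cases hα : α = (π.pathEnd γ).loser ε
    · subst hα
      rw [if_pos rfl]
      obtain ⟨qa, hqa, hTa, -⟩ := hret a
      obtain ⟨qb, hqb, hTb, -⟩ := hret b
      obtain ⟨q, hq, -, k, hk, hk'⟩ := hret ((π.pathEnd γ).loser ε)
      refine ⟨qb + qa, ?_, fun x hx => ?_, ?_⟩
      · push_cast
        rw [hqa, hqb]
        rcases hab with ⟨rfl, rfl⟩ | ⟨rfl, rfl⟩
        exacts [add_comm _ _, rfl]
      · obtain ⟨h1, h2, h3⟩ := hlos x hx
        rw [Function.iterate_add_apply, hTa x h1, hTb _ h2, h3]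
      · rcases hpt with ⟨rfl, h⟩ | ⟨rfl, h⟩
        · exact ⟨k, by omega, by rw [h, hk']⟩
        · have hb : b = (π.pathEnd γ).loser ε := by
            rcases hab with ⟨h1, h2⟩ | ⟨-, h2⟩
            · rw [h2, h1]
            · exact h2
          subst hb
          refine ⟨k + qa, by omega, ?_⟩
          rw [Function.iterate_add_apply,
            hTa _ (hlos _ (topPoint_mem_topInterval _ (hl _))).1, h, hk']
    · rw [if_neg hα, add_zero]
      obtain ⟨q, hq, hT, k, hk, hk'⟩ := hret α
      obtain ⟨hp, hx⟩ := hother α hα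
      exact ⟨q, hq, fun x hx' => by rw [hT x (hx x hx').1, (hx x hx').2], k, hk, by rw [hp, hk']⟩

end rauzy

end CombDatum

/-! ### Generalized interval exchanges -/

namespace GIET

variable {A : Type*} [Fintype A] {π : CombDatum A} (f : GIET π) {α β : A} {x y : ℝ}

theorem mapsTo_botInterval (hx : x ∈ π.topInterval f.topLen α) :
    f.toFun x ∈ π.botInterval f.botLen α := by
  rw [← f.image_eq]
  exact mem_image_of_mem _ hx

theorem exists_mem_topInterval (hx : x ∈ Ico (0 : ℝ) 1) : ∃ α, x ∈ π.topInterval f.topLen α :=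
  exists_mem_leftPt π.top f.topLen (by rwa [f.topLen_sum])

theorem exists_mem_botInterval (hx : x ∈ Ico (0 : ℝ) 1) : ∃ α, x ∈ π.botInterval f.botLen α :=
  exists_mem_leftPt π.bot f.botLen (by rwa [f.botLen_sum])

theorem topInterval_subset (α : A) : π.topInterval f.topLen α ⊆ Ico 0 1 := fun _ hx =>
  ⟨(leftPt_nonneg π.top (fun χ => (f.topLen_pos χ).le) α).trans hx.1,
    hx.2.trans_le ((leftPt_add_le_sum π.top (fun χ => (f.topLen_pos χ).le) α).trans_eq
      f.topLen_sum)⟩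

theorem botInterval_subset (α : A) : π.botInterval f.botLen α ⊆ Ico 0 1 := fun _ hx =>
  ⟨(leftPt_nonneg π.bot (fun χ => (f.botLen_pos χ).le) α).trans hx.1,
    hx.2.trans_le ((leftPt_add_le_sum π.bot (fun χ => (f.botLen_pos χ).le) α).trans_eq
      f.botLen_sum)⟩

theorem botInterval_unique (hα : x ∈ π.botInterval f.botLen α)
    (hβ : x ∈ π.botInterval f.botLen β) : α = β :=
  eq_of_mem_leftPt π.bot (fun χ => (f.botLen_pos χ).le) hα hβ

theorem bijOn : BijOn f.toFun (Ico 0 1) (Ico 0 1) := by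
  refine ⟨fun x hx => ?_, fun x hx y hy hxy => ?_, fun y hy => ?_⟩
  · obtain ⟨α, hα⟩ := f.exists_mem_topInterval hx
    exact f.botInterval_subset α (f.mapsTo_botInterval hα)
  · obtain ⟨α, hα⟩ := f.exists_mem_topInterval hx
    obtain ⟨β, hβ⟩ := f.exists_mem_topInterval hy
    obtain rfl : α = β := f.botInterval_unique (f.mapsTo_botInterval hα)
      (hxy ▸ f.mapsTo_botInterval hβ)
    exact (f.strictMonoOn α).injOn hα hβ hxy
  · obtain ⟨α, hα⟩ := f.exists_mem_botInterval hy
    rw [← f.image_eq] at hα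
    obtain ⟨x, hx, rfl⟩ := hα
    exact ⟨x, f.topInterval_subset α hx, rfl⟩

theorem inverse_mem (hy : y ∈ Ico (0 : ℝ) 1) : f.inverse y ∈ Ico (0 : ℝ) 1 :=
  Function.invFunOn_mem (f.bijOn.surjOn hy)

theorem toFun_inverse (hy : y ∈ Ico (0 : ℝ) 1) : f.toFun (f.inverse y) = y :=
  Function.invFunOn_eq (f.bijOn.surjOn hy)

theorem inverse_toFun (hx : x ∈ Ico (0 : ℝ) 1) : f.inverse (f.toFun x) = x :=
  f.bijOn.injOn (f.inverse_mem (f.bijOn.mapsTo hx)) hx (f.toFun_inverse (f.bijOn.mapsTo hx))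

theorem inverse_mem_topInterval (hy : y ∈ π.botInterval f.botLen α) :
    f.inverse y ∈ π.topInterval f.topLen α := by
  rw [← f.image_eq] at hy
  obtain ⟨x, hx, rfl⟩ := hy
  rwa [f.inverse_toFun (f.topInterval_subset α hx)]

theorem mem_topInterval_iff (hx : x ∈ Ico (0 : ℝ) 1) :
    x ∈ π.topInterval f.topLen α ↔ f.toFun x ∈ π.botInterval f.botLen α :=
  ⟨f.mapsTo_botInterval, fun h => by
    simpa [f.inverse_toFun hx] using f.inverse_mem_topInterval h⟩

theorem critPoint_mem (α : A) : f.critPoint α ∈ π.topInterval f.topLen α :=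
  ⟨le_rfl, by have := f.topLen_pos α; simp only [critPoint]; linarith⟩

theorem critValue_mem (α : A) : f.critValue α ∈ π.botInterval f.botLen α :=
  ⟨le_rfl, by have := f.botLen_pos α; simp only [critValue]; linarith⟩

theorem toFun_critPoint (α : A) : f.toFun (f.critPoint α) = f.critValue α := by
  have h := f.critValue_mem α
  refine le_antisymm ?_ (f.mapsTo_botInterval (f.critPoint_mem α)).1
  rw [← f.image_eq] at h
  obtain ⟨x, hx, hxe⟩ := h
  rw [← hxe]
  exact (f.strictMonoOn α).monotoneOn (f.critPoint_mem α) hx hx.1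

theorem inverse_critValue (α : A) : f.inverse (f.critValue α) = f.critPoint α := by
  rw [← toFun_critPoint, f.inverse_toFun (f.topInterval_subset α (f.critPoint_mem α))]

/-- The order of two points is determined by the letters of their intervals and by the order of
their images. -/
theorem lt_iff (hx : x ∈ π.topInterval f.topLen α) (hy : y ∈ π.topInterval f.topLen β) :
    x < y ↔ π.top α < π.top β ∨ α = β ∧ f.toFun x < f.toFun y := by
  have key : ∀ {α β x y}, x ∈ π.topInterval f.topLen α → y ∈ π.topInterval f.topLen β →
      π.top α < π.top β → x < y := fun {α β x y} hx hy h =>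
    hx.2.trans_le ((leftPt_add_le π.top (fun χ => (f.topLen_pos χ).le) h).trans hy.1)
  rcases lt_trichotomy (π.top α) (π.top β) with h | h | h
  · simp [h, key hx hy h]
  · obtain rfl := π.top.injective h
    simp [(f.strictMonoOn α).lt_iff_lt hx hy]
  · have : α ≠ β := by rintro rfl; exact lt_irrefl _ h
    simp [this, h.not_gt, (key hy hx h).le]

end GIET

namespace CombDatum

/-- An interval exchange of `[0, 1)` as a generalized interval exchange. -/
noncomputable def ietGIET {A : Type*} [Fintype A] (π : CombDatum A) (l : A → ℝ)
    (hl : ∀ χ, 0 < l χ) (hs : ∑ χ, l χ = 1) : GIET π where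
  topLen := l
  botLen := l
  topLen_pos := hl
  botLen_pos := hl
  topLen_sum := hs
  botLen_sum := hs
  toFun := π.iet l
  strictMonoOn α x hx y hy hxy := by
    rw [iet_apply π (fun χ => (hl χ).le) hx, iet_apply π (fun χ => (hl χ).le) hy]
    linarith
  continuousOn α := by
    refine ContinuousOn.congr (f := fun x => x + (π.botPoint l α - π.topPoint l α)) (by fun_prop) ?_
    intro x hx
    exact iet_apply π (fun χ => (hl χ).le) hx
  image_eq α := by
    rw [image_congr (fun x hx => iet_apply π (fun χ => (hl χ).le) hx), topInterval, botInterval]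
    simp only [image_add_const_Ico]
    congr 1 <;> ring

end CombDatum

/-! ### The reference points -/

/-- On a set on which `f` is bijective, the integer iterates of `f` are the integer powers of the
corresponding permutation. -/
theorem intIterate_eq_zpow {f : ℝ → ℝ} {s : Set ℝ} (hf : BijOn f s s) (i : ℤ) (x : s) :
    intIterate f s i x = (((BijOn.equiv f hf : Equiv.Perm s) ^ i) x : s) := by
  have hinv : ∀ x : s, Function.invFunOn f s x = ((BijOn.equiv f hf : Equiv.Perm s)⁻¹ x : s) := by
    intro x
    have h1 : f ((BijOn.equiv f hf : Equiv.Perm s)⁻¹ x : s) = x :=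
      congrArg Subtype.val (Equiv.apply_symm_apply (BijOn.equiv f hf) x)
    conv_lhs => rw [← h1]
    exact hf.injOn.leftInvOn_invFunOn (Subtype.coe_prop _)
  cases i with
  | ofNat n =>
    simp only [intIterate, Int.ofNat_eq_natCast, zpow_natCast]
    induction n generalizing x with
    | zero => rfl
    | succ n ih =>
      rw [Function.iterate_succ_apply, pow_succ, Equiv.Perm.mul_apply]
      exact ih (BijOn.equiv f hf x)
  | negSucc n =>
    simp only [intIterate, zpow_negSucc, ← inv_pow]
    generalize n + 1 = m
    induction m generalizing x with
    | zero => rfl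
    | succ n ih =>
      rw [Function.iterate_succ_apply, pow_succ, Equiv.Perm.mul_apply, hinv]
      exact ih _

namespace CombDatum

section reference

variable {A : Type*} [Fintype A] [Nontrivial A] [DecidableEq A] (π : CombDatum A)
  (γ : List RauzyType)

theorem returnTime_pos (hγ : (π.pathEnd γ).lastTop ≠ (π.pathEnd γ).lastBot) (α : A) :
    0 < π.returnTime γ α := by
  obtain ⟨q, hq, -, k, hk, -⟩ := (π.rauzy_induction γ hγ (l := 1) (by simp)).2 α
  omega

theorem numPoints_pos (hγ : (π.pathEnd γ).lastTop ≠ (π.pathEnd γ).lastBot) :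
    0 < π.numPoints γ :=
  Finset.sum_pos (fun α _ => π.returnTime_pos γ hγ α) Finset.univ_nonempty

theorem refLength_eq : π.refLength γ = π.pathLength γ (fun _ => (π.numPoints γ : ℝ)⁻¹) := by
  funext α
  simp [refLength, pathLength, Matrix.mulVec, dotProduct, Finset.mul_sum, mul_comm]

theorem refLength_pos (hγ : (π.pathEnd γ).lastTop ≠ (π.pathEnd γ).lastBot) (α : A) :
    0 < π.refLength γ α := by
  rw [refLength_eq]
  have := π.numPoints_pos γ hγ
  exact (π.rauzy_induction γ hγ (fun _ => by positivity)).1 α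

theorem sum_refLength (hγ : (π.pathEnd γ).lastTop ≠ (π.pathEnd γ).lastBot) :
    ∑ α, π.refLength γ α = 1 := by
  have h := π.numPoints_pos γ hγ
  have h1 : ∑ α, (π.pathMatrix γ).transpose.mulVec 1 α = π.numPoints γ := by
    simp only [numPoints, returnTime, Matrix.mulVec, dotProduct, Pi.one_apply, mul_one,
      Matrix.transpose_apply]
    exact Finset.sum_comm
  simp only [refLength]
  rw [← Finset.mul_sum, ← Int.cast_sum, h1]
  have : (π.numPoints γ : ℝ) ≠ 0 := by exact_mod_cast h.ne'
  field_simp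

/-- The reference map `T_γ` as a generalized interval exchange. -/
noncomputable def refGIET (hγ : (π.pathEnd γ).lastTop ≠ (π.pathEnd γ).lastBot) : GIET π :=
  π.ietGIET (π.refLength γ) (π.refLength_pos γ hγ) (π.sum_refLength γ hγ)

variable {π γ}

/-- The permutation of `[0, 1)` induced by `T_γ`. -/
noncomputable def refPerm (hγ : (π.pathEnd γ).lastTop ≠ (π.pathEnd γ).lastBot) :
    Equiv.Perm (Ico (0 : ℝ) 1) :=
  BijOn.equiv (π.refIET γ) (π.refGIET γ hγ).bijOn

theorem refPerm_coe (hγ : (π.pathEnd γ).lastTop ≠ (π.pathEnd γ).lastBot)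
    (x : Ico (0 : ℝ) 1) : (refPerm hγ x : ℝ) = π.refIET γ x := rfl

theorem refPerm_pow_coe (hγ : (π.pathEnd γ).lastTop ≠ (π.pathEnd γ).lastBot)
    (k : ℕ) (x : Ico (0 : ℝ) 1) :
    ((refPerm hγ ^ k) x : ℝ) = (π.refIET γ)^[k] x := by
  induction k generalizing x with
  | zero => rfl
  | succ k ih =>
    rw [Function.iterate_succ_apply, pow_succ, Equiv.Perm.mul_apply, ih, refPerm_coe]

/-- The critical point `u^t_α(T_γ)` as a point of `[0, 1)`. -/
noncomputable def refStart (hγ : (π.pathEnd γ).lastTop ≠ (π.pathEnd γ).lastBot)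
    (α : A) : Ico (0 : ℝ) 1 :=
  ⟨π.refCrit γ α, (π.refGIET γ hγ).topInterval_subset α ((π.refGIET γ hγ).critPoint_mem α)⟩

/-- The height of `α` is attained, and the return time of `α` takes the critical point of the
renormalized map to the corresponding critical value. -/
theorem returnTime_height (hγ : (π.pathEnd γ).lastTop ≠ (π.pathEnd γ).lastBot)
    (α : A) :
    (π.refIET γ)^[π.height γ α] (π.renormCrit γ α) = π.refCrit γ α ∧
    ∃ q : ℕ, (q : ℤ) = π.returnTime γ α ∧ π.renormCrit γ α ∈ Ico (0 : ℝ) 1 ∧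
      (π.refIET γ)^[q] (π.renormCrit γ α) =
        (π.pathEnd γ).botPoint (fun _ => (π.numPoints γ : ℝ)⁻¹) α := by
  have hN := π.numPoints_pos γ hγ
  have hc : (0 : ℝ) < (π.numPoints γ : ℝ)⁻¹ := by positivity
  obtain ⟨q, hq, hT, k, hk, hk'⟩ := (π.rauzy_induction γ hγ (fun _ => hc)).2 α
  rw [← refLength_eq] at hT hk'
  have hmem : π.height γ α ∈ {k : ℕ | (k : ℤ) < π.returnTime γ α ∧
    (π.refIET γ)^[k] (π.renormCrit γ α) = π.refCrit γ α} :=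
    Nat.sInf_mem ⟨k, by omega, hk'⟩
  refine ⟨hmem.2, q, hq, ?_, ?_⟩
  · rw [renormCrit, topPoint_eq_leftPt, leftPt_const]
    refine ⟨by positivity, ?_⟩
    rw [mul_inv_lt_iff₀ (by exact_mod_cast hN), one_mul]
    have h1 : (Fintype.card A : ℤ) ≤ π.numPoints γ := by
      have : (Fintype.card A : ℤ) = ∑ _ : A, 1 := by simp
      rw [this]
      exact Finset.sum_le_sum fun α _ => π.returnTime_pos γ hγ α
    have h2 := ((π.pathEnd γ).top α).isLt
    have h3 : ((((π.pathEnd γ).top α : ℕ) : ℤ)) < π.numPoints γ := by omega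
    exact_mod_cast h3
  · have h1 := topPoint_mem_topInterval (π.pathEnd γ) (α := α)
      (l := fun _ => (π.numPoints γ : ℝ)⁻¹) hc
    refine (hT _ h1).trans ?_
    rw [iet_apply _ (fun _ => hc.le) h1]
    ring

/-- The points `T_γ^i(u^t_α(T_γ))` are compatible with the identifications of labels. -/
theorem refPerm_zpow_eq_of_labelRel (hγ : (π.pathEnd γ).lastTop ≠ (π.pathEnd γ).lastBot)
    {x y : A × ℤ} (h : π.labelRel γ x y) :
    (refPerm hγ ^ x.2) (refStart hγ x.1) = (refPerm hγ ^ y.2) (refStart hγ y.1) := by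
  obtain ⟨α, i⟩ := x
  obtain ⟨β, j⟩ := y
  obtain ⟨h1, h2⟩ := h
  obtain ⟨ha, q, hq, ham, haq⟩ := returnTime_height hγ α
  obtain ⟨hb, -, -, hbm, -⟩ := returnTime_height hγ β
  simp only at h1 h2 ⊢
  have ea : refStart hγ α = (refPerm hγ ^ (π.height γ α : ℤ)) ⟨_, ham⟩ := by
    rw [zpow_natCast]
    exact Subtype.ext (by rw [refPerm_pow_coe]; exact ha.symm)
  have eb : refStart hγ β = (refPerm hγ ^ (π.height γ β : ℤ)) ⟨_, hbm⟩ := by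
    rw [zpow_natCast]
    exact Subtype.ext (by rw [refPerm_pow_coe]; exact hb.symm)
  have eab : (⟨_, hbm⟩ : Ico (0 : ℝ) 1) = (refPerm hγ ^ (q : ℤ)) ⟨_, ham⟩ := by
    rw [zpow_natCast]
    refine Subtype.ext ?_
    rw [refPerm_pow_coe]
    refine Eq.trans ?_ haq.symm
    change π.renormCrit γ β = _
    rw [renormCrit, botPoint_eq_leftPt, topPoint_eq_leftPt, leftPt_const,
      leftPt_const, h1]
  rw [ea, eb, eab, ← Equiv.Perm.mul_apply, ← Equiv.Perm.mul_apply, ← Equiv.Perm.mul_apply,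
    ← zpow_add, ← zpow_add, ← zpow_add]
  congr 2
  omega

/-- `refPoint` does not depend on the representative chosen in its definition. -/
theorem refPoint_label (hγ : (π.pathEnd γ).lastTop ≠ (π.pathEnd γ).lastBot)
    (α : A) (i : ℤ) :
    π.refPoint γ (π.label γ α i) = ((refPerm hγ ^ i) (refStart hγ α) : Ico (0 : ℝ) 1) := by
  have h : ∀ x : π.Label γ, Quot.lift (fun x : A × ℤ => (refPerm hγ ^ x.2) (refStart hγ x.1))
      (fun _ _ h => refPerm_zpow_eq_of_labelRel hγ h) x =
        (refPerm hγ ^ (Quot.out x).2) (refStart hγ (Quot.out x).1) := by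
    intro x
    conv_lhs => rw [← Quot.out_eq x]
  have h1 := h (π.label γ α i)
  change (refPerm hγ ^ i) (refStart hγ α) = _ at h1
  rw [h1]
  exact intIterate_eq_zpow (π.refGIET γ hγ).bijOn _ (refStart hγ _)

theorem refPoint_mem (hγ : (π.pathEnd γ).lastTop ≠ (π.pathEnd γ).lastBot)
    (x : π.Label γ) : π.refPoint γ x ∈ Ico (0 : ℝ) 1 := by
  obtain ⟨⟨α, i⟩, rfl⟩ := Quot.exists_rep x
  exact (refPoint_label hγ α i).symm ▸ Subtype.coe_prop _

theorem refPoint_succLabel (hγ : (π.pathEnd γ).lastTop ≠ (π.pathEnd γ).lastBot)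
    (x : π.Label γ) :
    π.refPoint γ (π.succLabel γ x) = π.refIET γ (π.refPoint γ x) := by
  obtain ⟨⟨α, i⟩, rfl⟩ := Quot.exists_rep x
  change π.refPoint γ (π.label γ α (i + 1)) = π.refIET γ (π.refPoint γ (π.label γ α i))
  rw [refPoint_label hγ, refPoint_label hγ, add_comm i, zpow_add, zpow_one, Equiv.Perm.mul_apply,
    refPerm_coe]

theorem refPoint_label_zero (hγ : (π.pathEnd γ).lastTop ≠ (π.pathEnd γ).lastBot)
    (α : A) : π.refPoint γ (π.label γ α 0) = π.refCrit γ α := by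
  rw [refPoint_label hγ]
  rfl

end reference

end CombDatum

/-! ### The Thurston map on configurations -/

namespace CombDatum

section configurations

variable {A : Type*} [Fintype A] [Nontrivial A] [DecidableEq A] {π : CombDatum A}
  {γ : List RauzyType} {v : π.Label γ → ℝ}

/-- The value at `a` of a configuration, with the convention that the point following the last one
is `1`. -/
def valueOrOne {L : Type*} (v : L → ℝ) (a : Option L) : ℝ := a.elim 1 v

/-- `a` is the label following `x` in the order of the reference points, or `none` if `x` is the
last label. -/
def IsNextOrNone (π : CombDatum A) (γ : List RauzyType) (x : π.Label γ) :
    Option (π.Label γ) → Prop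
  | none => π.IsMaxLabel γ x
  | some y => π.IsNextLabel γ x y

theorem mem_face_iff {x : π.Label γ} :
    v ∈ π.face γ x ↔ v ∈ π.boundary γ ∧ ∃ a, π.IsNextOrNone γ x a ∧ v x = valueOrOne v a := by
  refine and_congr_right fun _ => ⟨?_, ?_⟩
  · rintro (h | ⟨y, h⟩)
    exacts [⟨none, h⟩, ⟨some y, h⟩]
  · rintro ⟨a | y, h⟩
    exacts [Or.inl h, Or.inr ⟨y, h⟩]

/-- If there is a configuration, the reference points are distinct. -/
theorem refPoint_injective (hv : v ∈ π.configurations γ) : Function.Injective (π.refPoint γ) := by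
  intro x y h
  apply hv.2.1
  refine le_antisymm (not_lt.1 fun h' => ?_) (not_lt.1 fun h' => ?_)
  · exact absurd h ((hv.2.2.2 _ _).1 h').ne'
  · exact absurd h ((hv.2.2.2 _ _).1 h').ne

theorem le_iff_refPoint_le (hv : v ∈ π.configurations γ) (x y : π.Label γ) :
    v x ≤ v y ↔ π.refPoint γ x ≤ π.refPoint γ y := by
  rw [← not_lt, ← not_lt, hv.2.2.2]

theorem refPoint_label_one (hγ : (π.pathEnd γ).lastTop ≠ (π.pathEnd γ).lastBot) (α : A) :
    π.refPoint γ (π.label γ α 1) = (π.refGIET γ hγ).critValue α := by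
  refine (refPoint_succLabel hγ (π.label γ α 0)).trans ?_
  rw [refPoint_label_zero hγ]
  exact (π.refGIET γ hγ).toFun_critPoint α

/-- The critical value that follows `v([α, 1])`, or `1` if `α` is last in the bottom row. -/
noncomputable def nextValue (π : CombDatum A) (γ : List RauzyType) (v : π.Label γ → ℝ) (α : A) :
    ℝ :=
  if h : (π.bot α : ℕ) + 1 < Fintype.card A then
    v (π.label γ (π.bot.symm ⟨(π.bot α : ℕ) + 1, h⟩) 1)
  else 1

theorem tau_eq (v : π.Label γ → ℝ) (α : A) :
    π.tau γ v α = nextValue π γ v α - v (π.label γ α 1) := by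
  rw [tau, nextValue]
  split_ifs <;> rfl

theorem botPoint_tau (hγ : (π.pathEnd γ).lastTop ≠ (π.pathEnd γ).lastBot)
    (hv : v ∈ π.configurations γ) (α : A) :
    π.botPoint (π.tau γ v) α = v (π.label γ α 1) := by
  refine leftPt_eq_of_diff π.bot (g := fun α => v (π.label γ α 1)) ?_ ?_ α
  · intro β hβ
    rw [← hv.2.2.1]
    congr 1
    apply refPoint_injective hv
    rw [refPoint_label_one hγ, refPoint_label_zero hγ]
    have h1 : (π.refGIET γ hγ).critValue β = 0 := leftPt_of_val_eq_zero π.bot hβ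
    have h2 : π.refCrit γ π.firstTop = 0 := leftPt_of_val_eq_zero π.top (by simp [firstTop])
    rw [h1, h2]
  · intro β δ h
    have hlt : (π.bot β : ℕ) + 1 < Fintype.card A := h ▸ (π.bot δ).isLt
    have : π.bot.symm ⟨(π.bot β : ℕ) + 1, hlt⟩ = δ := by
      rw [Equiv.symm_apply_eq]
      exact Fin.ext h.symm
    rw [tau, dif_pos hlt, this]

theorem botPoint_add_tau (hγ : (π.pathEnd γ).lastTop ≠ (π.pathEnd γ).lastBot)
    (hv : v ∈ π.configurations γ) (α : A) :
    π.botPoint (π.tau γ v) α + π.tau γ v α = nextValue π γ v α := by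
  rw [botPoint_tau hγ hv, tau_eq]
  ring

theorem tau_mem_openSimplex (hγ : (π.pathEnd γ).lastTop ≠ (π.pathEnd γ).lastBot)
    (hv : v ∈ π.configurations γ) : π.tau γ v ∈ openSimplex A := by
  refine ⟨fun α => ?_, ?_⟩
  · rw [tau]
    split_ifs with h
    · rw [sub_pos, hv.2.2.2, refPoint_label_one hγ, refPoint_label_one hγ]
      have h1 := (π.refGIET γ hγ).botLen_pos α
      have h2 : (π.refGIET γ hγ).critValue (π.bot.symm ⟨(π.bot α : ℕ) + 1, h⟩) = _ :=
        leftPt_succ π.bot (l := (π.refGIET γ hγ).botLen) (α := α) (by simp)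
      rw [h2, GIET.critValue, botPoint_eq_leftPt]
      linarith
    · linarith [(hv.1 (π.label γ α 1)).2]
  · have h := π.bot_lastBot
    rw [← leftPt_last π.bot h, ← botPoint_eq_leftPt, botPoint_add_tau hγ hv, nextValue,
      dif_neg (by omega)]

/-- Configurations put corresponding points in corresponding intervals of the bottom partition. -/
theorem mem_botInterval_tau (hγ : (π.pathEnd γ).lastTop ≠ (π.pathEnd γ).lastBot)
    (hv : v ∈ π.configurations γ) {x : π.Label γ} {α : A}
    (hx : π.refPoint γ x ∈ π.botInterval (π.refLength γ) α) :
    v x ∈ π.botInterval (π.tau γ v) α := by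
  refine ⟨?_, ?_⟩
  · rw [botPoint_tau hγ hv, le_iff_refPoint_le hv, refPoint_label_one hγ]
    exact hx.1
  · rw [botPoint_add_tau hγ hv, nextValue]
    split_ifs with h
    · rw [hv.2.2.2, refPoint_label_one hγ]
      refine hx.2.trans_eq (leftPt_succ π.bot ?_).symm
      simp
    · exact (hv.1 x).2

variable {F : (A → ℝ) → GIET π}

theorem botLen_tau (hγ : (π.pathEnd γ).lastTop ≠ (π.pathEnd γ).lastBot) (hF : IsFullFamily F)
    (hv : v ∈ π.configurations γ) : (F (π.tau γ v)).botLen = π.tau γ v := by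
  have h := tau_mem_openSimplex hγ hv
  funext α
  exact eq_of_leftPt_eq π.bot (fun β => hF.critValue_eq _ h β)
    ((F (π.tau γ v)).botLen_sum.trans h.2.symm) α

/-- The image of a configuration by the Thurston map follows the itineraries of the reference
points. -/
theorem thurstonMap_mem_topInterval (hγ : (π.pathEnd γ).lastTop ≠ (π.pathEnd γ).lastBot)
    (hF : IsFullFamily F) (hv : v ∈ π.configurations γ) {x : π.Label γ} {α : A}
    (hx : π.refPoint γ x ∈ π.topInterval (π.refLength γ) α) :
    π.thurstonMap γ F v x ∈ π.topInterval (F (π.tau γ v)).topLen α := by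
  apply GIET.inverse_mem_topInterval
  rw [botLen_tau hγ hF hv]
  apply mem_botInterval_tau hγ hv
  rw [refPoint_succLabel hγ]
  exact (π.refGIET γ hγ).mapsTo_botInterval hx

theorem toFun_thurstonMap (hv : v ∈ π.configurations γ) (x : π.Label γ) :
    (F (π.tau γ v)).toFun (π.thurstonMap γ F v x) = v (π.succLabel γ x) :=
  GIET.toFun_inverse _ (hv.1 _)

theorem thurstonMap_label_zero (hγ : (π.pathEnd γ).lastTop ≠ (π.pathEnd γ).lastBot)
    (hF : IsFullFamily F) (hv : v ∈ π.configurations γ) (α : A) :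
    π.thurstonMap γ F v (π.label γ α 0) = (F (π.tau γ v)).critPoint α := by
  change (F (π.tau γ v)).inverse (v (π.label γ α 1)) = _
  rw [← botPoint_tau hγ hv, ← hF.critValue_eq _ (tau_mem_openSimplex hγ hv), GIET.inverse_critValue]

theorem exists_refPoint_mem_topInterval (hγ : (π.pathEnd γ).lastTop ≠ (π.pathEnd γ).lastBot)
    (x : π.Label γ) : ∃ α, π.refPoint γ x ∈ π.topInterval (π.refLength γ) α :=
  (π.refGIET γ hγ).exists_mem_topInterval (refPoint_mem hγ x)

theorem thurstonMap_mem_configurations (hγ : (π.pathEnd γ).lastTop ≠ (π.pathEnd γ).lastBot)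
    (hF : IsFullFamily F) (hv : v ∈ π.configurations γ) :
    π.thurstonMap γ F v ∈ π.configurations γ := by
  have hlt : ∀ x y, π.thurstonMap γ F v x < π.thurstonMap γ F v y ↔
      π.refPoint γ x < π.refPoint γ y := by
    intro x y
    obtain ⟨α, hα⟩ := exists_refPoint_mem_topInterval hγ x
    obtain ⟨β, hβ⟩ := exists_refPoint_mem_topInterval hγ y
    rw [(F (π.tau γ v)).lt_iff (thurstonMap_mem_topInterval hγ hF hv hα)
      (thurstonMap_mem_topInterval hγ hF hv hβ), (π.refGIET γ hγ).lt_iff hα hβ,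
      toFun_thurstonMap hv, toFun_thurstonMap hv, hv.2.2.2, refPoint_succLabel hγ,
      refPoint_succLabel hγ]
    rfl
  refine ⟨fun x => GIET.inverse_mem _ (hv.1 _), fun x y h => ?_, ?_, hlt⟩
  · apply refPoint_injective hv
    refine le_antisymm (not_lt.1 fun h' => ?_) (not_lt.1 fun h' => ?_)
    · exact absurd h ((hlt _ _).2 h').ne'
    · exact absurd h ((hlt _ _).2 h').ne
  · rw [thurstonMap_label_zero hγ hF hv]
    exact leftPt_of_val_eq_zero π.top (by simp [firstTop])

end configurations

end CombDatum

/-! ### Closed graphs and their Hausdorff limits -/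

namespace GIET

variable {A : Type*} [Fintype A] {π : CombDatum A} (f : GIET π) {α : A}

theorem mem_branchClosure {x : ℝ} (hx : x ∈ π.topInterval f.topLen α) :
    WithLp.toLp 2 (x, f.toFun x) ∈ f.branchClosure α :=
  subset_closure (mem_image_of_mem _ hx)

/-- The upper right corner of a branch. -/
theorem corner_mem_branchClosure (α : A) :
    WithLp.toLp 2 (π.topPoint f.topLen α + f.topLen α, π.botPoint f.botLen α + f.botLen α) ∈
      f.branchClosure α := by
  set b := π.topPoint f.topLen α + f.topLen α with hb
  set d := π.botPoint f.botLen α + f.botLen α with hd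
  have hev : ∀ᶠ x in 𝓝[<] b, x ∈ π.topInterval f.topLen α :=
    Ico_mem_nhdsLT (by linarith [f.topLen_pos α])
  have hf : Tendsto f.toFun (𝓝[<] b) (𝓝 d) := by
    refine tendsto_order.2 ⟨fun y hy => ?_, fun y hy => ?_⟩
    · obtain ⟨z, hz1, hz2⟩ := exists_between (max_lt hy
        (show π.botPoint f.botLen α < d by linarith [f.botLen_pos α]))
      have hz : z ∈ π.botInterval f.botLen α := ⟨(le_max_right _ _).trans hz1.le, hz2⟩
      rw [← f.image_eq] at hz
      obtain ⟨x, hx, rfl⟩ := hz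
      filter_upwards [hev, Ioo_mem_nhdsLT hx.2] with t ht htx
      exact (le_max_left _ _).trans_lt (hz1.trans (f.strictMonoOn α hx ht htx.1))
    · filter_upwards [hev] with t ht
      exact (f.mapsTo_botInterval ht).2.trans hy
  refine mem_closure_of_tendsto (b := 𝓝[<] b) (f := fun x => WithLp.toLp 2 (x, f.toFun x)) ?_ ?_
  · refine ((WithLp.prod_continuous_toLp 2 ℝ ℝ).tendsto _).comp (Tendsto.prodMk_nhds ?_ hf)
    exact tendsto_nhdsWithin_of_tendsto_nhds tendsto_id
  · filter_upwards [hev] with x hx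
    exact mem_image_of_mem _ hx

theorem isCompact_branchClosure (α : A) : IsCompact (f.branchClosure α) := by
  have hbox : IsCompact (WithLp.toLp 2 '' (Icc (0 : ℝ) 1 ×ˢ Icc (0 : ℝ) 1) :
      Set (WithLp 2 (ℝ × ℝ))) :=
    (isCompact_Icc.prod isCompact_Icc).image (WithLp.prod_continuous_toLp 2 ℝ ℝ)
  refine hbox.of_isClosed_subset isClosed_closure (closure_minimal ?_ hbox.isClosed)
  rintro _ ⟨x, hx, rfl⟩
  exact mem_image_of_mem _ ⟨Ico_subset_Icc_self (f.topInterval_subset α hx),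
    Ico_subset_Icc_self (f.botInterval_subset α (f.mapsTo_botInterval hx))⟩

/-- The second coordinate is injective on the closure of the graph of a branch: by strict
monotonicity, the closure contains no horizontal segment. -/
theorem snd_injOn_branchClosure (α : A) : InjOn (fun p => p.snd) (f.branchClosure α) := by
  have hf : Continuous fun p : WithLp 2 (ℝ × ℝ) => p.fst := by fun_prop
  have hs : Continuous fun p : WithLp 2 (ℝ × ℝ) => p.snd := by fun_prop
  have hfst : ∀ p ∈ f.branchClosure α, π.topPoint f.topLen α ≤ p.fst ∧
      p.fst ≤ π.topPoint f.topLen α + f.topLen α := by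
    intro p hp
    have hc : IsClosed {p : WithLp 2 (ℝ × ℝ) | π.topPoint f.topLen α ≤ p.fst ∧
        p.fst ≤ π.topPoint f.topLen α + f.topLen α} :=
      (isClosed_le continuous_const hf).inter (isClosed_le hf continuous_const)
    refine closure_minimal ?_ hc hp
    rintro _ ⟨x, hx, rfl⟩
    exact ⟨hx.1, hx.2.le⟩
  have hle : ∀ m ∈ π.topInterval f.topLen α, ∀ p ∈ f.branchClosure α,
      m ≤ p.fst ∨ p.snd ≤ f.toFun m := by
    intro m hm p hp
    have hc : IsClosed {p : WithLp 2 (ℝ × ℝ) | m ≤ p.fst ∨ p.snd ≤ f.toFun m} :=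
      (isClosed_le continuous_const hf).union (isClosed_le hs continuous_const)
    refine closure_minimal ?_ hc hp
    rintro _ ⟨x, hx, rfl⟩
    rcases le_or_gt m x with h | h
    exacts [Or.inl h, Or.inr (f.strictMonoOn α hx hm h).le]
  have hge : ∀ m ∈ π.topInterval f.topLen α, ∀ p ∈ f.branchClosure α,
      p.fst ≤ m ∨ f.toFun m ≤ p.snd := by
    intro m hm p hp
    have hc : IsClosed {p : WithLp 2 (ℝ × ℝ) | p.fst ≤ m ∨ f.toFun m ≤ p.snd} :=
      (isClosed_le hf continuous_const).union (isClosed_le continuous_const hs)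
    refine closure_minimal ?_ hc hp
    rintro _ ⟨x, hx, rfl⟩
    rcases le_or_gt x m with h | h
    exacts [Or.inl h, Or.inr (f.strictMonoOn α hm hx h).le]
  have key : ∀ p ∈ f.branchClosure α, ∀ q ∈ f.branchClosure α, p.fst < q.fst →
      p.snd ≠ q.snd := by
    intro p hp q hq hpq h
    obtain ⟨m, hm1, hm2⟩ := exists_between hpq
    obtain ⟨m', hm1', hm2'⟩ := exists_between hm2
    have hm : m ∈ π.topInterval f.topLen α :=
      ⟨(hfst p hp).1.trans hm1.le, hm2.trans_le (hfst q hq).2⟩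
    have hm' : m' ∈ π.topInterval f.topLen α :=
      ⟨hm.1.trans hm1'.le, hm2'.trans_le (hfst q hq).2⟩
    have h1 := (hle m hm p hp).resolve_left (not_le.2 hm1)
    have h2 := (hge m' hm' q hq).resolve_left (not_le.2 hm2')
    linarith [f.strictMonoOn α hm hm' hm1']
  intro p hp q hq h
  have h1 : p.fst = q.fst := by
    rcases lt_trichotomy p.fst q.fst with h' | h' | h'
    · exact absurd h (key p hp q hq h')
    · exact h'
    · exact absurd h.symm (key q hq p hp h')
  exact WithLp.ofLp_injective 2 (Prod.ext h1 h)

end GIET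

namespace ExtGIET

variable {A : Type*} [Fintype A] {π : CombDatum A}

theorem isCompact_part (α : A) (D : ExtGIET π) : IsCompact (D.part α) := by
  cases D with
  | regular f => exact f.isCompact_branchClosure α
  | degenerate D =>
    rw [part]
    split_ifs
    exacts [D.regularPart.isCompact_branchClosure _, isCompact_singleton]

theorem snd_injOn_part (α : A) (D : ExtGIET π) : InjOn (fun p => p.snd) (D.part α) := by
  cases D with
  | regular f => exact f.snd_injOn_branchClosure α
  | degenerate D =>
    rw [part]
    split_ifs
    exacts [D.regularPart.snd_injOn_branchClosure _, injOn_singleton _ _]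

theorem part_nonempty (α : A) (D : ExtGIET π) : (D.part α).Nonempty := by
  cases D with
  | regular f => exact ⟨_, f.corner_mem_branchClosure α⟩
  | degenerate D =>
    rw [part]
    split_ifs
    exacts [⟨_, D.regularPart.corner_mem_branchClosure _⟩, singleton_nonempty _]

end ExtGIET

/-- Let the compact sets `K i` converge to the compact set `K₀` in the Hausdorff distance, and let
`g` be a Lipschitz function that is injective on `K₀`. If `p i ∈ K i` and `g (p i)` converges, then
`p i` converges to a point of `K₀`. -/
theorem exists_tendsto_of_hausdorffDist {ι X : Type*} [MetricSpace X] {l : Filter ι} [l.NeBot]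
    {K : ι → Set X} {K₀ : Set X} (hK : ∀ i, IsCompact (K i)) (hK₀ : IsCompact K₀)
    (hne : K₀.Nonempty) (hlim : Tendsto (fun i => Metric.hausdorffDist (K i) K₀) l (𝓝 0))
    {g : X → ℝ} (hg : LipschitzWith 1 g) (hinj : InjOn g K₀) {p : ι → X} (hp : ∀ i, p i ∈ K i)
    {y : ℝ} (hy : Tendsto (fun i => g (p i)) l (𝓝 y)) :
    ∃ p₀ ∈ K₀, g p₀ = y ∧ Tendsto p l (𝓝 p₀) := by
  have hex : ∀ i, ∃ q ∈ K₀, dist (p i) q ≤ Metric.hausdorffDist (K i) K₀ := by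
    intro i
    obtain ⟨q, hq, hd⟩ := hK₀.exists_infDist_eq_dist hne (p i)
    refine ⟨q, hq, hd ▸ Metric.infDist_le_hausdorffDist_of_mem (hp i) ?_⟩
    exact Metric.hausdorffEDist_ne_top_of_nonempty_of_bounded ⟨_, hp i⟩ hne (hK i).isBounded
      hK₀.isBounded
  choose q hq hpq using hex
  have hd : Tendsto (fun i => dist (p i) (q i)) l (𝓝 0) :=
    squeeze_zero (fun _ => dist_nonneg) hpq hlim
  have hgq : Tendsto (fun i => g (q i)) l (𝓝 y) := by
    refine (tendsto_iff_of_dist ?_).1 hy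
    refine squeeze_zero (fun _ => dist_nonneg) (fun i => ?_) hd
    simpa using hg.dist_le_mul (p i) (q i)
  obtain ⟨p₀, hp₀, hc⟩ := hK₀.exists_mapClusterPt (f := l) (u := q)
    (le_principal_iff.2 (mem_map.2 (univ_mem' hq)))
  have hgc : ∀ x ∈ K₀, MapClusterPt x l q → g x = y := fun x _ hx => by
    have h1 : MapClusterPt (g x) l (g ∘ q) := hx.continuousAt_comp hg.continuous.continuousAt
    have h2 : ClusterPt (g x) (𝓝 y) := ClusterPt.mono h1 hgq
    exact eq_of_nhds_neBot h2
  refine ⟨p₀, hp₀, hgc p₀ hp₀ hc, (tendsto_iff_of_dist hd).2 ?_⟩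
  exact hK₀.tendsto_nhds_of_unique_mapClusterPt (Eventually.of_forall hq) fun x hx hcx =>
    hinj hx hp₀ ((hgc x hx hcx).trans (hgc p₀ hp₀ hc).symm)

namespace ExtGIET

variable {A : Type*} [Fintype A] {π : CombDatum A}

/-- Let `G` be continuous on the closed simplex and let `σ i` converge to `τ` there. If the points
`p i` lie in the parts with letter `α` of `G (σ i)` and their second coordinates converge, then they
converge to a point of the part of `G τ`. -/
theorem exists_tendsto_of_mem_part {G : (A → ℝ) → ExtGIET π}
    (hG : ContinuousOnDist G (stdSimplex ℝ A)) {ι : Type*} {l : Filter ι} [l.NeBot]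
    {σ : ι → A → ℝ} {τ : A → ℝ} (hτ : τ ∈ stdSimplex ℝ A) (hσ : ∀ i, σ i ∈ stdSimplex ℝ A)
    (hlim : Tendsto σ l (𝓝 τ)) {α : A} {p : ι → WithLp 2 (ℝ × ℝ)}
    (hp : ∀ i, p i ∈ (G (σ i)).part α) {y : ℝ} (hy : Tendsto (fun i => (p i).snd) l (𝓝 y)) :
    ∃ p₀ ∈ (G τ).part α, p₀.snd = y ∧ Tendsto p l (𝓝 p₀) := by
  have h1 : Tendsto (fun i => (G (σ i)).distance (G τ)) l (𝓝 0) :=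
    (hG τ hτ).comp (tendsto_nhdsWithin_iff.2 ⟨hlim, Eventually.of_forall hσ⟩)
  have h2 : Tendsto (fun i => Metric.hausdorffDist ((G (σ i)).part α) ((G τ).part α)) l (𝓝 0) :=
    squeeze_zero (fun _ => Metric.hausdorffDist_nonneg)
      (fun i => Finset.single_le_sum
        (f := fun β => Metric.hausdorffDist ((G (σ i)).part β) ((G τ).part β))
        (fun β _ => Metric.hausdorffDist_nonneg) (Finset.mem_univ α)) h1
  refine exists_tendsto_of_hausdorffDist (fun i => (G (σ i)).isCompact_part α)
    ((G τ).isCompact_part α) ((G τ).part_nonempty α) h2 (g := fun p => p.snd) ?_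
    ((G τ).snd_injOn_part α) hp hy
  refine LipschitzWith.of_dist_le_mul fun p q => ?_
  rw [NNReal.coe_one, one_mul, WithLp.prod_dist_eq_of_L2]
  exact Real.le_sqrt_of_sq_le (le_add_of_nonneg_left (sq_nonneg _))

end ExtGIET

/-! ### Degenerate configurations -/

namespace CombDatum

section faces

variable {A : Type*} [Fintype A] [Nontrivial A] [DecidableEq A] {π : CombDatum A}
  {γ : List RauzyType} {v : π.Label γ → ℝ} {F : (A → ℝ) → GIET π}

theorem tendsto_valueOrOne {L ι : Type*} {l : Filter ι} {u : ι → L → ℝ} {v : L → ℝ}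
    (h : ∀ x, Tendsto (fun i => u i x) l (𝓝 (v x))) (a : Option L) :
    Tendsto (fun i => valueOrOne (u i) a) l (𝓝 (valueOrOne v a)) := by
  cases a
  exacts [tendsto_const_nhds, h _]

theorem thurstonMap_mem_branchClosure (hγ : (π.pathEnd γ).lastTop ≠ (π.pathEnd γ).lastBot)
    (hF : IsFullFamily F) (hv : v ∈ π.configurations γ) {x : π.Label γ} {α : A}
    (hx : π.refPoint γ x ∈ π.topInterval (π.refLength γ) α) :
    WithLp.toLp 2 (π.thurstonMap γ F v x, v (π.succLabel γ x)) ∈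
      (F (π.tau γ v)).branchClosure α := by
  rw [← toFun_thurstonMap (F := F) hv]
  exact GIET.mem_branchClosure _ (thurstonMap_mem_topInterval hγ hF hv hx)

/-- For `x` with letter `α`, the point following the image of `x` by the Thurston map and the point
following the configuration point of `succLabel x` are the coordinates of a point of the closed
graph of the branch with letter `α`: either another point of the configuration lies over the same
branch, or the point is the upper right corner of the branch. -/
theorem exists_next_mem_branchClosure (hγ : (π.pathEnd γ).lastTop ≠ (π.pathEnd γ).lastBot)
    (hF : IsFullFamily F) (hinj : Function.Injective (π.refPoint γ)) {x : π.Label γ} {α : A}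
    (hx : π.refPoint γ x ∈ π.topInterval (π.refLength γ) α) {b : Option (π.Label γ)}
    (hb : π.IsNextOrNone γ (π.succLabel γ x) b) :
    ∃ a, π.IsNextOrNone γ x a ∧ ∀ u ∈ π.configurations γ,
      WithLp.toLp 2 (valueOrOne (π.thurstonMap γ F u) a, valueOrOne u b) ∈
        (F (π.tau γ u)).branchClosure α := by
  set E := π.refGIET γ hγ with hE
  have hsucc : ∀ z, π.refPoint γ (π.succLabel γ z) = E.toFun (π.refPoint γ z) :=
    refPoint_succLabel hγ
  have hmem : ∀ z, π.refPoint γ z ∈ Ico (0 : ℝ) 1 := refPoint_mem hγ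
  have hsx : π.refPoint γ (π.succLabel γ x) ∈ π.botInterval E.botLen α := by
    rw [hsucc]
    exact E.mapsTo_botInterval hx
  have hx' : π.refPoint γ x ∈ π.topInterval E.topLen α := hx
  have hmono : ∀ z, π.refPoint γ z ∈ π.topInterval E.topLen α →
      (π.refPoint γ x < π.refPoint γ z ↔
        π.refPoint γ (π.succLabel γ x) < π.refPoint γ (π.succLabel γ z)) := by
    intro z hz
    rw [hsucc, hsucc, (E.strictMonoOn α).lt_iff_lt hx' hz]
  -- A label beyond `x` in the reference order, but in another interval, is beyond that interval.
  have hbeyond : ∀ z, π.refPoint γ x < π.refPoint γ z → π.refPoint γ z ∉ π.topInterval E.topLen α →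
      π.topPoint E.topLen α + E.topLen α ≤ π.refPoint γ z := by
    intro z hxz hz
    by_contra! h
    exact hz ⟨hx'.1.trans hxz.le, h⟩
  by_cases hcase : ∃ z, b = some z ∧ π.refPoint γ z ∈ π.botInterval E.botLen α
  · obtain ⟨z, rfl, hz⟩ := hcase
    obtain ⟨⟨β, i⟩, rfl⟩ := Quot.exists_rep z
    set y := π.label γ β (i - 1) with hy
    have hyz : π.succLabel γ y = Quot.mk _ (β, i) := by
      change π.label γ β (i - 1 + 1) = π.label γ β i
      rw [sub_add_cancel]
    rw [← hyz] at hz hb ⊢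
    have hyα : π.refPoint γ y ∈ π.topInterval E.topLen α := by
      rwa [E.mem_topInterval_iff (hmem y), ← hsucc]
    have hxy : π.refPoint γ x < π.refPoint γ y := (hmono y hyα).2 hb.1
    refine ⟨some y, ⟨hxy, fun w hw => ?_⟩, fun u hu =>
      thurstonMap_mem_branchClosure hγ hF hu hyα⟩
    by_cases hwα : π.refPoint γ w ∈ π.topInterval E.topLen α
    · have h1 := hb.2 _ ((hmono w hwα).1 hw)
      rw [hsucc, hsucc] at h1
      exact ((E.strictMonoOn α).le_iff_le hyα hwα).1 h1
    · exact hyα.2.le.trans (hbeyond w hw hwα)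
  · -- Now `x` is the last label in its interval, and so is `succLabel x`.
    have hlast : ∀ z, π.refPoint γ z ∈ π.botInterval E.botLen α →
        ¬ π.refPoint γ (π.succLabel γ x) < π.refPoint γ z := by
      intro z hz hlt
      cases b with
      | none => exact absurd (hb z) (not_le.2 hlt)
      | some w =>
        refine hcase ⟨w, rfl, hsx.1.trans hb.1.le, (hb.2 z hlt).trans_lt hz.2⟩
    have hbot : ∀ u : π.Label γ → ℝ, valueOrOne u b = nextValue π γ u α := by
      intro u
      rw [nextValue]
      split_ifs with h
      · set β := π.bot.symm ⟨(π.bot α : ℕ) + 1, h⟩ with hβ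
        have h1 : π.refPoint γ (π.label γ β 1) = π.botPoint E.botLen α + E.botLen α := by
          rw [refPoint_label_one hγ]
          exact leftPt_succ π.bot (by simp [β])
        have h2 : π.refPoint γ (π.succLabel γ x) < π.refPoint γ (π.label γ β 1) := by
          rw [h1]; exact hsx.2
        cases b with
        | none => exact absurd (hb _) (not_le.2 h2)
        | some w =>
          have h3 : w = π.label γ β 1 := by
            refine hinj (le_antisymm (hb.2 _ h2) ?_)
            rw [h1]
            by_contra! h4
            exact hlast w ⟨hsx.1.trans hb.1.le, h4⟩ hb.1
          rw [h3]
          rfl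
      · cases b with
        | none => rfl
        | some w =>
          have h1 : π.botPoint E.botLen α + E.botLen α = 1 :=
            (leftPt_last π.bot (by omega)).trans E.botLen_sum
          exact absurd hb.1 (hlast w ⟨hsx.1.trans hb.1.le, h1 ▸ (hmem w).2⟩)
    have htop : ∃ a, π.IsNextOrNone γ x a ∧ ∀ u ∈ π.configurations γ,
        valueOrOne (π.thurstonMap γ F u) a =
          π.topPoint (F (π.tau γ u)).topLen α + (F (π.tau γ u)).topLen α := by
      have hbeyond' : ∀ z, π.refPoint γ x < π.refPoint γ z →
          π.topPoint E.topLen α + E.topLen α ≤ π.refPoint γ z := fun z hz =>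
        hbeyond z hz fun hzα => hlast _ (hsucc z ▸ E.mapsTo_botInterval hzα) ((hmono z hzα).1 hz)
      rcases Nat.lt_or_ge ((π.top α : ℕ) + 1) (Fintype.card A) with h | h
      · set β := π.top.symm ⟨(π.top α : ℕ) + 1, h⟩ with hβ
        have h1 : π.refPoint γ (π.label γ β 0) = π.topPoint E.topLen α + E.topLen α := by
          rw [refPoint_label_zero hγ]
          exact leftPt_succ π.top (by simp [β])
        refine ⟨some (π.label γ β 0), ⟨h1 ▸ hx'.2, fun z hz => h1 ▸ hbeyond' z hz⟩,
          fun u hu => ?_⟩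
        refine (thurstonMap_label_zero hγ hF hu β).trans ?_
        exact leftPt_succ π.top (by simp [β])
      · refine ⟨none, fun z => ?_, fun u _ => ?_⟩
        · by_contra! hz
          have h1 : π.topPoint E.topLen α + E.topLen α = 1 :=
            (leftPt_last π.top (by omega)).trans E.topLen_sum
          exact absurd (hbeyond' z hz) (not_le.2 (h1 ▸ (hmem z).2))
        · exact ((leftPt_last π.top (by omega)).trans (F (π.tau γ u)).topLen_sum).symm
    obtain ⟨a, ha, hau⟩ := htop
    refine ⟨a, ha, fun u hu => ?_⟩
    have h1 := (F (π.tau γ u)).corner_mem_branchClosure α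
    rwa [botLen_tau hγ hF hu, botPoint_add_tau hγ hu, ← hau u hu, ← hbot] at h1

theorem exists_seq_of_mem_closedConfigurations (hv : v ∈ π.closedConfigurations γ) :
    ∃ u : ℕ → π.Label γ → ℝ, (∀ n, u n ∈ π.configurations γ) ∧ Tendsto u atTop (𝓝 v) := by
  rcases hv with hv | hv
  · exact ⟨fun _ => v, fun _ => hv, tendsto_const_nhds⟩
  · obtain ⟨x, hx⟩ := mem_iUnion.1 hv
    obtain ⟨u, hu, hlim⟩ := hx.1.1
    exact ⟨u, hu, tendsto_pi_nhds.2 hlim⟩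

theorem continuous_tau : Continuous (π.tau γ) := by
  refine continuous_pi fun α => ?_
  simp only [tau]
  split_ifs <;> fun_prop

theorem tau_mem_stdSimplex (hγ : (π.pathEnd γ).lastTop ≠ (π.pathEnd γ).lastBot)
    (hv : v ∈ π.closedConfigurations γ) : π.tau γ v ∈ stdSimplex ℝ A := by
  obtain ⟨u, hu, hlim⟩ := exists_seq_of_mem_closedConfigurations hv
  exact (isClosed_stdSimplex ℝ A).mem_of_tendsto ((continuous_tau.tendsto v).comp hlim)
    (Eventually.of_forall fun n =>
      have h := tau_mem_openSimplex hγ (hu n)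
      ⟨fun α => (h.1 α).le, h.2⟩)

theorem notMem_boundary_of_mem_configurations (hv : v ∈ π.configurations γ) :
    v ∉ π.boundary γ := by
  rintro ⟨-, ⟨x, y, hne, h⟩ | ⟨x, h⟩⟩
  · exact hne (hv.2.1 h)
  · exact (hv.1 x).2.ne h

end faces

end CombDatum

theorem proposition6p1 {A : Type*} [Fintype A] [Nontrivial A] [DecidableEq A]
    (π : CombDatum A) (hπ : π.IsAdmissible)
    (γ : List RauzyType) (hγ : (π.pathEnd γ).IsCyclic)
    (F : (A → ℝ) → GIET π) (hF : IsFullFamily F) :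
    MapsTo (π.thurstonMap γ F) (π.configurations γ) (π.configurations γ) ∧
    ∃ That : π.closedConfigurations γ → π.closedConfigurations γ,
      (∀ v : π.closedConfigurations γ, (v : π.Label γ → ℝ) ∈ π.configurations γ →
        (That v : π.Label γ → ℝ) = π.thurstonMap γ F v) ∧
      Continuous That ∧
      (∀ v : π.closedConfigurations γ, (v : π.Label γ → ℝ) ∈ π.boundary γ →
        (That v : π.Label γ → ℝ) ∈ π.boundary γ) ∧
      (∀ (α : A) (i : ℤ) (v : π.closedConfigurations γ),
        (v : π.Label γ → ℝ) ∈ π.face γ (π.label γ α i) →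
        (That v : π.Label γ → ℝ) ∈ π.face γ (π.label γ α (i - 1))) := by
  have hne := hγ.lastTop_ne_lastBot
  have hmaps : ∀ v ∈ π.configurations γ, π.thurstonMap γ F v ∈ π.configurations γ :=
    fun v hv => CombDatum.thurstonMap_mem_configurations hne hF hv
  obtain ⟨G, hGF, hG⟩ := hF.extends_continuously
  have hpart : ∀ v ∈ π.configurations γ, ∀ α,
      (G (π.tau γ v)).part α = (F (π.tau γ v)).branchClosure α := fun v hv α => by
    rw [hGF _ (CombDatum.tau_mem_openSimplex hne hv)]
    rfl
  choose a ha using fun x => CombDatum.exists_refPoint_mem_topInterval (π := π) (γ := γ) hne x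
  have hconf : ∀ v ∈ π.configurations γ, ∀ x,
      WithLp.toLp 2 (π.thurstonMap γ F v x, v (π.succLabel γ x)) ∈
        (G (π.tau γ v)).part (a x) := fun v hv x => by
    rw [hpart v hv]
    exact CombDatum.thurstonMap_mem_branchClosure hne hF hv (ha x)
  have hτ : ∀ v ∈ π.closedConfigurations γ, π.tau γ v ∈ stdSimplex ℝ A := fun v hv =>
    CombDatum.tau_mem_stdSimplex hne hv
  have hex : ∀ v ∈ π.closedConfigurations γ, ∀ x, ∃ t : ℝ,
      WithLp.toLp 2 (t, v (π.succLabel γ x)) ∈ (G (π.tau γ v)).part (a x) := by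
    intro v hv x
    obtain ⟨u, hu, hlim⟩ := CombDatum.exists_seq_of_mem_closedConfigurations hv
    obtain ⟨p, hp, hpy, -⟩ := ExtGIET.exists_tendsto_of_mem_part hG (hτ v hv)
      (fun n => hτ _ (Or.inl (hu n))) ((CombDatum.continuous_tau.tendsto v).comp hlim)
      (fun n => hconf _ (hu n) x) (tendsto_pi_nhds.1 hlim (π.succLabel γ x))
    refine ⟨p.fst, ?_⟩
    rw [← hpy]
    exact hp
  -- `T v x` is the first coordinate of the only point with second coordinate `v (succLabel x)` in
  -- the part of `G (τ v)` with the letter of `x`.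
  choose! T hT using hex
  have huniq : ∀ v ∈ π.closedConfigurations γ, ∀ x, ∀ p ∈ (G (π.tau γ v)).part (a x),
      p.snd = v (π.succLabel γ x) → p.fst = T v x := fun v hv x p hp hpy =>
    congrArg (fun p => p.fst) (ExtGIET.snd_injOn_part _ _ hp (hT v hv x) hpy)
  have hTconf : ∀ v ∈ π.configurations γ, T v = π.thurstonMap γ F v := fun v hv =>
    funext fun x => (huniq v (Or.inl hv) x _ (hconf v hv x) rfl).symm
  have hcont : Continuous fun v : π.closedConfigurations γ => T v := by
    refine continuous_pi fun x => continuous_iff_continuousAt.2 fun v => ?_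
    obtain ⟨p, hp, hpy, hlim⟩ := ExtGIET.exists_tendsto_of_mem_part (l := 𝓝 v) hG (hτ v v.2)
      (fun u : π.closedConfigurations γ => hτ u u.2)
      ((CombDatum.continuous_tau.comp continuous_subtype_val).tendsto v) (fun u => hT u u.2 x)
      (((continuous_apply (π.succLabel γ x)).comp continuous_subtype_val).tendsto v)
    have hc : Continuous fun p : WithLp 2 (ℝ × ℝ) => p.fst := by fun_prop
    have h := (hc.tendsto p).comp hlim
    rw [huniq v v.2 x p hp hpy] at h
    exact h
  have hseq : ∀ v ∈ π.closedConfigurations γ, ∀ u : ℕ → π.Label γ → ℝ,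
      (∀ n, u n ∈ π.configurations γ) → Tendsto u atTop (𝓝 v) →
      ∀ x, Tendsto (fun n => π.thurstonMap γ F (u n) x) atTop (𝓝 (T v x)) := by
    intro v hv u hu hlim x
    have h1 : Tendsto (fun n => (⟨u n, Or.inl (hu n)⟩ : π.closedConfigurations γ)) atTop
        (𝓝 ⟨v, hv⟩) := tendsto_subtype_rng.2 hlim
    have h2 := ((continuous_apply x).comp hcont).tendsto _ |>.comp h1
    refine h2.congr fun n => ?_
    exact congrFun (hTconf _ (hu n)) x
  have hface : ∀ (α : A) (i : ℤ), ∀ v ∈ π.closedConfigurations γ, v ∈ π.face γ (π.label γ α i) →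
      T v ∈ π.face γ (π.label γ α (i - 1)) := by
    intro α i v hv hvf
    obtain ⟨-, b, hb, hvb⟩ := CombDatum.mem_face_iff.1 hvf
    obtain ⟨u, hu, hlim⟩ := CombDatum.exists_seq_of_mem_closedConfigurations hv
    set x := π.label γ α (i - 1) with hx
    have hsx : π.succLabel γ x = π.label γ α i := by
      change π.label γ α (i - 1 + 1) = _
      rw [sub_add_cancel]
    rw [← hsx] at hb hvb
    -- The point over the successor of `x` lies over the same branch closure as the one over `x`; in
    -- the limit both have the same second coordinate, hence they coincide.
    obtain ⟨c, hc, hcu⟩ := CombDatum.exists_next_mem_branchClosure hne hF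
      (CombDatum.refPoint_injective (hu 0)) (ha x) hb
    have hTu := hseq v hv u hu hlim
    obtain ⟨p, hp, hpy, hplim⟩ := ExtGIET.exists_tendsto_of_mem_part hG (hτ v hv)
      (fun n => hτ _ (Or.inl (hu n))) ((CombDatum.continuous_tau.tendsto v).comp hlim)
      (p := fun n => WithLp.toLp 2 (CombDatum.valueOrOne (π.thurstonMap γ F (u n)) c,
        CombDatum.valueOrOne (u n) b))
      (fun n => (hpart _ (hu n) (a x)).symm ▸ hcu (u n) (hu n))
      (CombDatum.tendsto_valueOrOne (tendsto_pi_nhds.1 hlim) b)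
    have hfst : Continuous fun p : WithLp 2 (ℝ × ℝ) => p.fst := by fun_prop
    have h1 : p.fst = CombDatum.valueOrOne (T v) c :=
      tendsto_nhds_unique ((hfst.tendsto p).comp hplim) (CombDatum.tendsto_valueOrOne hTu c)
    have hTx : T v x = CombDatum.valueOrOne (T v) c := by
      rw [← h1]
      exact (huniq v hv x p hp (hpy.trans hvb.symm)).symm
    refine CombDatum.mem_face_iff.2 ⟨⟨⟨_, fun n => hmaps _ (hu n), hTu⟩, ?_⟩, c, hc, hTx⟩
    cases c with
    | none => exact Or.inr ⟨x, hTx⟩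
    | some y =>
      refine Or.inl ⟨x, y, ?_, hTx⟩
      rintro rfl
      exact lt_irrefl _ hc.1
  have hface' : ∀ v ∈ π.closedConfigurations γ, v ∉ π.configurations γ →
      ∃ x, T v ∈ π.face γ x := by
    intro v hv hvO
    obtain ⟨x, hx⟩ := mem_iUnion.1 (hv.resolve_left hvO)
    obtain ⟨⟨α, i⟩, rfl⟩ := Quot.exists_rep x
    exact ⟨_, hface α i v hv hx⟩
  have hclosed : ∀ v ∈ π.closedConfigurations γ, T v ∈ π.closedConfigurations γ := by
    intro v hv
    by_cases hvO : v ∈ π.configurations γ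
    · exact Or.inl (hTconf v hvO ▸ hmaps v hvO)
    · exact Or.inr (mem_iUnion.2 (hface' v hv hvO))
  refine ⟨hmaps, fun v => ⟨T v, hclosed v v.2⟩, fun v hv => hTconf v hv,
    hcont.subtype_mk _, fun v hv => ?_, fun α i v hv => hface α i v v.2 hv⟩
  obtain ⟨x, hx⟩ := hface' v v.2 fun h => CombDatum.notMem_boundary_of_mem_configurations h hv
  exact hx.1
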